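/- Let $k$ be an algebraically closed field of arbitrary characteristic and let $X$ be an irreducible smooth proper curve over $k$ of genus $g\ge 2$, with function field $k(X)$. For $\xi\in X(k)$ let $v_\xi$ be the associated valuation of $k(X)$, with $v_\xi(0)=\infty$; we say that $f$ has a zero of order at least $n\in\mathbb{Z}$ at $\xi$ if $v_\xi(f)\ge n$. Fix $\infty\in X(k)$, embed $X$ in its jacobian $J$ with base point $\infty$, and for $N\ge 1$ let $X[N]$ be the set of points of $X(k)$ whose image in $J$ is killed by $N$, i.e. the set of $\xi$ such that the divisor $N([\xi]-[\infty])$ is principal. Let $d$ be a positive integer for which there is a function $x\in k(X)$, finite away from $\infty$ and with a pole of order $d$ at $\infty$, such that $k(X)/k(x)$ is separable; fix such an $x$, let $\pi:X\to\mathbb{P}^1$ be the morphism defined by $x$, and let $\mathcal{R}\subset X$ be the set of ramification points of $\pi$ (points of ramification degree at least $2$). Let $(D_n)_{n\ge 0}$ be the unique Hasse--Schmidt derivation of $k(X)$, trivial on $k$, such that $D_n(x^m)=\binom{m}{n}x^{m-n}$ for all $m,n\ge 0$. Let $0=\delta_1<\delta_2<\cdots$ be the orders of poles at $\infty$ of the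 functions in $\mathcal{O}_X(X-\{\infty\})$, and for each $n\ge 1$ let $y_n\in\mathcal{O}_X(X-\{\infty\})$ be any function with $v_\infty(y_n)=-\delta_n$. For $N\ge 1$ put $D_N=\dim_k H^0(X,\mathcal{O}_X(N[\infty]))$ (not to be confused with the derivation) and let $\mathcal{M}_N$ be the $D_N\times N$ matrix over $k(X)$ with entries $D_{j-1}(y_i)$, $1\le i\le D_N$, $1\le j\le N$. For integers $1\le s_1<\cdots<s_{D_N}\le N$ let $\Pi_{N,s}$ be the minor of $\mathcal{M}_N$ obtained from the columns $s_1,\dots,s_{D_N}$, and let $\Delta_N$ be the leftmost minor ($s_i=i$ for all $i$). Let $N\ge 2$ and let $\xi\in X[N]$ with $\xi\notin\mathcal{R}$. (i) For every $s$ as above, $\Pi_{N,s}$ has a zero of order at least $N+1-s_{D_N}$ at $\xi$. (ii) For every integer $r\ge 0$, if $\ell=\lfloor r/d\rfloor+1$, then $\Delta_{N+r}$ has a zero of order at least $\ell\,(N+\ell-D_{N+r})$ at $\xi$. (iii) If $N\ge 2g-1$ then, for every integer $r\ge 0$ and with $\ell$ as in (ii), $$\ell\,(N+\ell-D_{N+r})=\Big(g-r+\Big\lfloor\frac{r}{d}\Big\rfloor\Big)\Big(\Big\lfloor\frac{r}{d}\Big\rfloor+1\Big),$$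 so that $\Delta_{N+r}$ has a zero of order at least $\big(g-r+\lfloor r/d\rfloor\big)\big(\lfloor r/d\rfloor+1\big)$ at $\xi$. -/

import Mathlib

/-- `D = (D_n)` is a Hasse-Schmidt derivation of the field `F`, trivial on `k`, which is the
standard one on `k(x)`: `D_n (x ^ m) = binom(m, n) x ^ (m - n)` (the binomial coefficient vanishes
when `m < n`, where the exponent is truncated). -/
structure IsStandardHasseSchmidt (k : Type*) {F : Type*} [Field k] [Field F] [Algebra k F]
    (x : F) (D : ℕ → F →ₗ[k] F) : Prop where
  zero : ∀ f, D 0 f = f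
  leibniz : ∀ n f g, D n (f * g) = ∑ ij ∈ Finset.HasAntidiagonal.antidiagonal n, D ij.1 f * D ij.2 g
  pow : ∀ m n : ℕ, D n (x ^ m) = (m.choose n : F) * x ^ (m - n)

section
open PowerSeries
variable {k F : Type*} [Field k] [Field F] [Algebra k F] {x : F}

theorem taylor_unique_aux (hsep : Algebra.IsSeparable (IntermediateField.adjoin k {x}) F)
    {φ ψ : F →ₐ[k] F⟦X⟧} (hφ : ∀ f, constantCoeff (φ f) = f) (hψ : ∀ f, constantCoeff (ψ f) = f)
    (h : φ x = ψ x) : φ = ψ := by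
  have h1 : ∀ a ∈ IntermediateField.adjoin k {x}, φ a = ψ a := by
    intro a ha
    induction ha using IntermediateField.adjoin_induction with
    | mem y hy => rw [Set.mem_singleton_iff.mp hy, h]
    | algebraMap c => rw [AlgHom.commutes, AlgHom.commutes]
    | add a b _ _ ha hb => rw [map_add, map_add, ha, hb]
    | inv a _ ha =>
      by_cases h0 : a = 0
      · simp [h0]
      · have e1 : φ a * φ a⁻¹ = 1 := by rw [← map_mul, mul_inv_cancel₀ h0, map_one]
        have e2 : φ a * ψ a⁻¹ = 1 := by rw [ha, ← map_mul, mul_inv_cancel₀ h0, map_one]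
        have : φ a ≠ 0 := fun h => by simp [h] at e1
        exact mul_left_cancel₀ this (e1.trans e2.symm)
    | mul a b _ _ ha hb => rw [map_mul, map_mul, ha, hb]
  let L := IntermediateField.adjoin k {x}
  let _ : Algebra L F⟦X⟧ := ((φ : F →+* F⟦X⟧).comp (algebraMap L F)).toAlgebra
  let φ' : F →ₐ[L] F⟦X⟧ := { (φ : F →+* F⟦X⟧) with commutes' := fun r => rfl }
  let ψ' : F →ₐ[L] F⟦X⟧ :=
    { (ψ : F →+* F⟦X⟧) with commutes' := fun r => (h1 _ r.2).symm }
  have := Algebra.FormallyUnramified.of_isSeparable L F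
  have hinf : ⨅ i, (Ideal.span {(X : F⟦X⟧)}) ^ i = ⊥ := by
    rw [eq_bot_iff]
    intro f hf
    rw [Ideal.mem_bot]
    ext n
    have := (Ideal.mem_iInf.mp hf) (n + 1)
    rw [Ideal.span_singleton_pow, Ideal.mem_span_singleton, X_pow_dvd_iff] at this
    simpa using this n (Nat.lt_succ_self n)
  have key : φ' = ψ' := by
    refine Algebra.FormallyUnramified.ext_of_iInf (I := Ideal.span {(X : F⟦X⟧)}) hinf ?_
    intro f
    rw [Ideal.Quotient.eq, Ideal.mem_span_singleton, X_dvd_iff, map_sub, sub_eq_zero]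
    exact (hφ f).trans (hψ f).symm
  ext1 f
  exact congrArg (fun (g : F →ₐ[L] F⟦X⟧) => g f) key

theorem exists_ringHom_lift_of_isSeparable {L F S : Type*} [Field L] [Field F] [Algebra L F]
    [Algebra.IsSeparable L F] [CommRing S] (I : Ideal S) [IsAdicComplete I S] (σ : L →+* S)
    (q : F →+* S ⧸ I) (h : ∀ l, q (algebraMap L F l) = Ideal.Quotient.mk I (σ l)) :
    ∃ g : F →+* S, (∀ l, g (algebraMap L F l) = σ l) ∧ ∀ f, Ideal.Quotient.mk I (g f) = q f := by
  let _ : Algebra L S := σ.toAlgebra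
  let q' : F →ₐ[L] S ⧸ I := { q with commutes' := h }
  have := Algebra.FormallyEtale.of_isSeparable L F
  obtain ⟨g, hg⟩ := Algebra.FormallySmooth.exists_mkₐ_comp_eq_of_isAdicComplete (R := L) q'
  exact ⟨g, fun l => g.commutes l, fun f => congrArg (fun (u : F →ₐ[L] S ⧸ I) => u f) hg⟩

theorem taylor_exists_aux (hx : Transcendental k x)
    (hsep : Algebra.IsSeparable (IntermediateField.adjoin k {x}) F) :
    ∃ φ : F →ₐ[k] F⟦X⟧, (∀ f, constantCoeff (φ f) = f) ∧ φ x = C x + X := by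
  let L := IntermediateField.adjoin k {x}
  let ψ : Polynomial k →ₐ[k] F⟦X⟧ := Polynomial.aeval (C x + X)
  have hψ : ∀ p, constantCoeff (ψ p) = Polynomial.aeval x p := by
    intro p
    induction p using Polynomial.induction_on' with
    | add p q hp hq => simp [hp, hq]
    | monomial n a =>
      simp [ψ, Polynomial.aeval_monomial, PowerSeries.algebraMap_apply]
  have hu : ∀ y : nonZeroDivisors (Polynomial k), IsUnit (ψ y) := by
    intro y
    rw [isUnit_iff_constantCoeff, hψ, isUnit_iff_ne_zero]
    intro h0
    exact nonZeroDivisors.ne_zero y.2 ((transcendental_iff.mp hx) _ h0)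
  let ψR : RatFunc k →ₐ[k] F⟦X⟧ := IsLocalization.liftAlgHom (M := nonZeroDivisors (Polynomial k)) hu
  let e := RatFunc.algEquivOfTranscendental x hx
  have hψR : ∀ p, ψR (algebraMap (Polynomial k) (RatFunc k) p) = ψ p := fun p => by
    simp [ψR]
  have hc : ∀ r, constantCoeff (ψR r) = (e r : F) := by
    have : (constantCoeff (R := F)).comp (ψR : RatFunc k →+* F⟦X⟧) =
        (algebraMap L F).comp (e : RatFunc k →+* L) := by
      refine IsLocalization.ringHom_ext (nonZeroDivisors (Polynomial k)) ?_
      refine RingHom.ext fun p => ?_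
      simp only [RingHom.comp_apply, RingHom.coe_coe, hψR, hψ]
      refine Eq.trans ?_ (congrArg (fun l : L => (l : F))
        (RatFunc.algEquivOfTranscendental_algebraMap x hx p)).symm
      simp
    exact fun r => RingHom.congr_fun this r
  let σ : L →ₐ[k] F⟦X⟧ := ψR.comp (e.symm : L →ₐ[k] RatFunc k)
  have hσ : ∀ l, constantCoeff (σ l) = (l : F) := fun l => by
    simp only [σ, AlgHom.comp_apply, hc]
    simp
  let I : Ideal F⟦X⟧ := Ideal.span {(X : F⟦X⟧)}
  have hI : ∀ a b : F⟦X⟧, constantCoeff a = constantCoeff b →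
      Ideal.Quotient.mk I a = Ideal.Quotient.mk I b := by
    intro a b hab
    rw [Ideal.Quotient.eq, Ideal.mem_span_singleton, X_dvd_iff, map_sub, sub_eq_zero, hab]
  obtain ⟨g, hgL, hg⟩ := exists_ringHom_lift_of_isSeparable I (σ : L →+* F⟦X⟧)
    ((Ideal.Quotient.mk I).comp (C (R := F))) (fun l => hI _ _ (by
      rw [constantCoeff_C]
      exact (hσ l).symm))
  have hgk : ∀ c : k, g (algebraMap k F c) = algebraMap k F⟦X⟧ c := fun c => by
    have h1 := hgL (algebraMap k L c)
    exact h1.trans (σ.commutes c)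
  refine ⟨{ g with commutes' := hgk }, ?_, ?_⟩
  · intro f
    have h1 : Ideal.Quotient.mk I (g f) = Ideal.Quotient.mk I (C f) := hg f
    rw [Ideal.Quotient.eq, Ideal.mem_span_singleton, X_dvd_iff, map_sub, sub_eq_zero,
      constantCoeff_C] at h1
    exact h1
  · have hxL : x ∈ L := IntermediateField.mem_adjoin_simple_self k x
    have h2 := hgL ⟨x, hxL⟩
    have h3 : e (algebraMap (Polynomial k) (RatFunc k) Polynomial.X) = ⟨x, hxL⟩ := by
      apply Subtype.ext
      simp [e]
    have h4 : σ ⟨x, hxL⟩ = C x + X := by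
      simp only [σ, AlgHom.comp_apply]
      rw [← h3]
      exact (congrArg ψR (e.symm_apply_apply _)).trans ((hψR _).trans (by simp [ψ]))
    exact h2.trans h4

theorem taylor_pow (x : F) (m n : ℕ) :
    coeff n ((C x + X) ^ m) = (m.choose n : F) * x ^ (m - n) := by
  have h : (C x + X : F⟦X⟧) ^ m = ((Polynomial.X + Polynomial.C x) ^ m : Polynomial F) := by
    simp [add_comm]
  rw [h, Polynomial.coeff_coe, Polynomial.coeff_X_add_C_pow, mul_comm]

/-- The standard Hasse-Schmidt derivation of `k(x)` extends uniquely to any separable algebraic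
extension `F` of `k(x)`. -/
theorem existsUnique_isStandardHasseSchmidt (hx : Transcendental k x)
    (hsep : Algebra.IsSeparable (IntermediateField.adjoin k {x}) F) :
    ∃! D : ℕ → F →ₗ[k] F, IsStandardHasseSchmidt k x D := by
  have build : ∀ D : ℕ → F →ₗ[k] F, IsStandardHasseSchmidt k x D →
      ∃ φ : F →ₐ[k] F⟦X⟧, (∀ f, constantCoeff (φ f) = f) ∧ φ x = C x + X ∧
        ∀ n f, coeff n (φ f) = D n f := by
    intro D hD
    have h1 : ∀ n, D n 1 = if n = 0 then 1 else 0 := fun n => by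
      have := hD.pow 0 n
      rw [pow_zero] at this
      rw [this]
      rcases n with _ | n <;> simp
    let φ : F →ₐ[k] F⟦X⟧ := AlgHom.ofLinearMap
      { toFun := fun f => PowerSeries.mk fun n => D n f
        map_add' := fun a b => by ext n; simp
        map_smul' := fun c a => by ext n; simp }
      (by ext n; simp [h1, coeff_one])
      (fun a b => by ext n; simp [hD.leibniz, coeff_mul])
    have hφ : ∀ n f, coeff n (φ f) = D n f := fun n f => by simp [φ]
    refine ⟨φ, fun f => ?_, ?_, hφ⟩
    · rw [← coeff_zero_eq_constantCoeff_apply, hφ, hD.zero]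
    · ext n
      have := hD.pow 1 n
      rw [pow_one] at this
      rw [hφ, this, ← taylor_pow, pow_one]
  obtain ⟨φ, h0, h1⟩ := taylor_exists_aux hx hsep
  refine ⟨fun n => (coeff n).restrictScalars k ∘ₗ φ.toLinearMap, ⟨?_, ?_, ?_⟩, ?_⟩
  · intro f
    simpa using h0 f
  · intro n f g
    simp [coeff_mul]
  · intro m n
    simp only [LinearMap.comp_apply, AlgHom.toLinearMap_apply, map_pow, h1]
    exact taylor_pow x m n
  · intro D hD
    obtain ⟨ψ, g0, g1, g2⟩ := build D hD
    have := taylor_unique_aux hsep g0 h0 (g1.trans h1.symm)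
    funext n
    ext f
    rw [← g2, this]
    rfl

open Classical in
/-- The sequence `(D_n)` of Hasse-Schmidt derivatives with respect to `x` on `F`: the unique one
satisfying `IsStandardHasseSchmidt`, which exists by `existsUnique_isStandardHasseSchmidt` when
`x` is transcendental and `F / k(x)` is separable. -/
noncomputable def hasseSchmidt (k : Type*) {F : Type*} [Field k] [Field F] [Algebra k F]
    (x : F) : ℕ → F →ₗ[k] F :=
  if h : ∃ D : ℕ → F →ₗ[k] F, IsStandardHasseSchmidt k x D then h.choose else 0

end

universe u

open AlgebraicGeometry CategoryTheory

/-- An irreducible smooth proper curve over the field `k`: a scheme, proper and smooth of relative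
dimension one over `Spec k`, which is integral (for smooth schemes over a field this is the same
as being irreducible). -/
structure SmoothProperCurve (k : Type u) [Field k] where
  X : Scheme.{u}
  str : X ⟶ Spec (CommRingCat.of k)
  isIntegral : IsIntegral X
  isProper : IsProper str
  smooth : SmoothOfRelativeDimension 1 str

namespace SmoothProperCurve

variable {k : Type u} [Field k] (C : SmoothProperCurve k)

instance : IsIntegral C.X := C.isIntegral
instance : IsProper C.str := C.isProper
instance : SmoothOfRelativeDimension 1 C.str := C.smooth
instance : IsLocallyNoetherian C.X := LocallyOfFiniteType.isLocallyNoetherian C.str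

instance : Nonempty (⊤ : C.X.Opens) := ⟨⟨genericPoint C.X, trivial⟩⟩

/-- Closed points of `X` (that is, elements of `X(k)`, when `k` is algebraically closed). -/
abbrev Point : Type u := {ξ : C.X // IsClosed ({ξ} : Set C.X)}

/-- The function field `k(X)`. -/
abbrev K : Type u := C.X.functionField

noncomputable instance : Algebra k C.K :=
  ((Scheme.ΓSpecIso (CommRingCat.of k)).inv ≫ C.str.appTop ≫
    C.X.germToFunctionField ⊤).hom.toAlgebra

/-- The local ring `O_{X,ξ}`, as a `k`-subspace of `k(X)`. -/
noncomputable def localRing (ξ : C.Point) : Submodule k C.K where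
  carrier := Set.range (algebraMap (C.X.presheaf.stalk ξ.1) C.K)
  add_mem' := by
    rintro _ _ ⟨a, rfl⟩ ⟨b, rfl⟩
    exact ⟨a + b, map_add _ _ _⟩
  zero_mem' := ⟨0, map_zero _⟩
  smul_mem' := by
    rintro c _ ⟨a, rfl⟩
    have h : algebraMap k C.K c = algebraMap (C.X.presheaf.stalk ξ.1) C.K
        (C.X.presheaf.germ (⊤ : C.X.Opens) ξ.1 (TopologicalSpace.Opens.mem_top _)
          (((Scheme.ΓSpecIso (CommRingCat.of k)).inv ≫ C.str.appTop).hom c)) := by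
      rw [Scheme.algebraMap_germ_eq_germToFunctionField]
      rfl
    exact ⟨_ * a, by rw [map_mul, ← h, Algebra.smul_def]⟩

open Classical in
/-- The valuation `v_ξ` of `k(X)` (the order of vanishing at `ξ`), with `v_ξ(0) = ∞`. -/
noncomputable def v (ξ : C.Point) (f : C.K) : WithTop ℤ :=
  if f = 0 then ⊤ else ((Scheme.ord f ξ.1 : ℤ) : WithTop ℤ)

/-- The adeles (repartitions) of `X`: families of rational functions indexed by the closed points,
almost all of them regular at the corresponding point. -/
def adeles : Submodule k (C.Point → C.K) where
  carrier := {a | {ξ | a ξ ∉ C.localRing ξ}.Finite}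
  add_mem' := by
    intro a b ha hb
    refine (ha.union hb).subset fun ξ hξ => ?_
    by_contra h
    simp only [Set.mem_union, Set.mem_ofPred_eq, not_or, not_not] at h
    exact hξ ((C.localRing ξ).add_mem h.1 h.2)
  zero_mem' := by simp
  smul_mem' := by
    intro c a ha
    exact ha.subset fun ξ hξ h => hξ ((C.localRing ξ).smul_mem c h)

/-- The cohomology group `H¹(X, O_X)`, computed by the flasque resolution
`0 → O_X → k(X) → ⨁_ξ k(X) / O_{X,ξ} → 0`: it is the cokernel of `k(X) → ⨁_ξ k(X) / O_{X,ξ}` on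
global sections, that is, the adeles modulo the sum of `k(X)`, embedded diagonally, and the
space of adeles that are regular everywhere. -/
abbrev H1 : Type u :=
  C.adeles ⧸ (LinearMap.range (LinearMap.pi fun _ : C.Point => (LinearMap.id : C.K →ₗ[k] C.K)) ⊔
    Submodule.pi Set.univ C.localRing).comap C.adeles.subtype

/-- The genus `dim_k H¹(X, O_X)`. -/
noncomputable def genus : ℕ := Module.finrank k C.H1

abbrev Divisor : Type u := C.Point →₀ ℤ

theorem ord_one (z : C.X) : Scheme.ord (1 : C.K) z = 0 := by
  have := Scheme.ord_mul (x := z) (one_ne_zero (α := C.K)) (one_ne_zero (α := C.K))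
  rw [mul_one] at this
  omega

theorem ord_inv (z : C.X) {f : C.K} (hf : f ≠ 0) : Scheme.ord f⁻¹ z = - Scheme.ord f z := by
  have := Scheme.ord_mul (x := z) hf (inv_ne_zero hf)
  rw [mul_inv_cancel₀ hf, ord_one] at this
  omega

/-- The group of divisors of non-zero rational functions. -/
noncomputable def principalDivisors : AddSubgroup C.Divisor where
  carrier := {D | ∃ f : C.K, f ≠ 0 ∧ ∀ ξ, C.v ξ f = (D ξ : ℤ)}
  zero_mem' := ⟨1, one_ne_zero, fun ξ => by simp [v, ord_one]⟩
  add_mem' := by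
    rintro D E ⟨f, hf, hD⟩ ⟨g, hg, hE⟩
    refine ⟨f * g, mul_ne_zero hf hg, fun ξ => ?_⟩
    have h1 := hD ξ
    have h2 := hE ξ
    simp only [v, hf, hg, mul_eq_zero, or_self, if_false, WithTop.coe_inj] at h1 h2 ⊢
    rw [Scheme.ord_mul hf hg, h1, h2, Finsupp.add_apply]
  neg_mem' := by
    rintro D ⟨f, hf, hD⟩
    refine ⟨f⁻¹, inv_ne_zero hf, fun ξ => ?_⟩
    have h1 := hD ξ
    simp only [v, hf, inv_eq_zero, if_false, WithTop.coe_inj] at h1 ⊢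
    rw [ord_inv _ _ hf, h1, Finsupp.neg_apply]

/-- The group `J(k)` of points of the jacobian: divisors of degree zero modulo linear equivalence
(`k` algebraically closed). -/
abbrev Jacobian : Type u :=
  (Finsupp.degree : C.Divisor →+ ℤ).ker ⧸
    C.principalDivisors.addSubgroupOf (Finsupp.degree : C.Divisor →+ ℤ).ker

/-- The embedding of `X` in its jacobian with base point `inf`. -/
noncomputable def abelJacobi (inf ξ : C.Point) : C.Jacobian :=
  QuotientAddGroup.mk ⟨Finsupp.single ξ 1 - Finsupp.single inf 1, by
    simp [AddMonoidHom.mem_ker]⟩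

/-- `X[N]`: the points of `X` whose image in `J` is killed by `N`. -/
def torsionPoints (inf : C.Point) (N : ℕ) : Set C.Point := {ξ | N • C.abelJacobi inf ξ = 0}

/-- `O_X(X - {inf})`: the rational functions that are finite away from `inf`. -/
noncomputable def affineRing (inf : C.Point) : Submodule k C.K :=
  ⨅ (ξ : C.Point) (_ : ξ ≠ inf), C.localRing ξ

/-- `O_X(N[inf])`: the rational functions finite away from `inf`, with a pole of order at most `N`
at `inf`. -/
def sections (inf : C.Point) (N : ℕ) : Set C.K :=
  {f | f ∈ C.affineRing inf ∧ ((-(N : ℤ) : ℤ) : WithTop ℤ) ≤ C.v inf f}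

/-- `D_N = dim_k O_X(N[inf])` (the set `sections` is a `k`-subspace of `k(X)`, and `Set.finrank`
is the dimension of the subspace spanned by a set). -/
noncomputable def dimSections (inf : C.Point) (N : ℕ) : ℕ := Set.finrank k (C.sections inf N)

/-- `f` is finite away from `inf` and has a pole of order exactly `m` at `inf`. -/
def HasPoleOnlyAt (inf : C.Point) (m : ℕ) (f : C.K) : Prop :=
  f ∈ C.affineRing inf ∧ C.v inf f = ((-(m : ℤ) : ℤ) : WithTop ℤ)

/-- `δ_1 < δ_2 < ⋯`: the increasing enumeration, starting at index `1`, of the orders of poles at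
`inf` of functions that are finite away from `inf`. -/
noncomputable def poleOrder (inf : C.Point) (n : ℕ) : ℕ :=
  Nat.nth (fun m => ∃ f, C.HasPoleOnlyAt inf m f) (n - 1)

/-- The set of ramification points of the morphism `π : X → ℙ¹` defined by `x`. A uniformizer of
`ℙ¹` at `π(ξ)` is `x - c`, where `c = x(ξ)`, when `x` is finite at `ξ`, and `1 / x` when `ξ` is a
pole of `x`; the ramification degree is the order at `ξ` of this function, and `ξ` is a
ramification point when it is at least `2`. -/
def ramificationPoints (x : C.K) : Set C.Point :=
  {ξ | (∃ c : k, 2 ≤ C.v ξ (x - algebraMap k C.K c)) ∨ 2 ≤ C.v ξ x⁻¹}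

/-- The matrix `M_N`, with `D_N` rows and `N` columns, whose `(i, j)` entry is `D_{j-1}(y_i)` for
`1 ≤ i ≤ D_N` and `1 ≤ j ≤ N`; rows and columns are indexed here from `0`. -/
noncomputable def matrixM (inf : C.Point) (x : C.K) (y : ℕ → C.K) (N : ℕ) :
    Matrix (Fin (C.dimSections inf N)) (Fin N) C.K :=
  Matrix.of fun i j => hasseSchmidt k x j (y (i + 1))

/-- The minor `Π_{N,s}` of `M_N` obtained from the columns `s`. -/
noncomputable def minorPi (inf : C.Point) (x : C.K) (y : ℕ → C.K) (N : ℕ)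
    (s : Fin (C.dimSections inf N) ↪o Fin N) : C.K :=
  ((C.matrixM inf x y N).submatrix id s).det

/-- The leftmost minor `Δ_N` of `M_N`; see `Delta_eq_minorPi`. -/
noncomputable def Delta (inf : C.Point) (x : C.K) (y : ℕ → C.K) (N : ℕ) : C.K :=
  (Matrix.of fun i j : Fin (C.dimSections inf N) => hasseSchmidt k x j (y (i + 1))).det

theorem Delta_eq_minorPi (inf : C.Point) (x : C.K) (y : ℕ → C.K) (N : ℕ)
    (h : C.dimSections inf N ≤ N) :
    C.Delta inf x y N = C.minorPi inf x y N (Fin.castLEOrderEmb h) := rfl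

end SmoothProperCurve

/-!
The idea is to replace the functions `y_n` by others that vanish to high order at `ξ`.

As `ξ ≠ inf` is a torsion point, there is a function `f` with divisor `N [ξ] - N [inf]`; as `ξ` is
unramified and `x` is finite there, `x - c` is a uniformizer at `ξ` for some constant `c`. So
`f * (x - c) ^ m` is regular away from `inf`, has a pole of order `N + d * m` at `inf` and a zero of
order `N + m` at `ξ`. Replacing `y_n` by another function with the same order of the pole at `inf`
multiplies the matrix by a triangular matrix of constants, which does not change the order of a
minor (`v_det_eq_of_hasPoleOnlyAt`). Hence the rows of pole order `N`, `N + d`, `N + 2d`, … can be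
taken to come from these functions. The derivation `D_j` lowers the order of vanishing at the
unramified point `ξ` by at most `j` and preserves regularity (`le_v_hasseSchmidt`), so each entry
of such a row has a zero of order at least `N + m - j`, and the expansion of the determinant over
permutations gives the bounds (i) and (ii).

What remains is to compute `D_N`. It is the number of orders of poles at `inf` that are at most `N`
(`dimSections_eq_count`). The genus is defined as the dimension of `H¹(X, O_X)`, in terms of adeles,
and it is the number of gaps, the natural numbers that are not such orders (`genus_eq_card_gaps`):
the principal parts at `inf` of the gap orders are a basis of `H¹`, since by strong approximation
(`affineAdeles_eq_top`) each class comes from a principal part at `inf`. The orders of poles form a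
semigroup, hence by a symmetry argument all `g` gaps are less than `2g`
(`Nat.lt_two_mul_card_of_gap`). So `D_N = N + 1 - g` for `N ≥ 2g - 1`, without recourse to duality.
There being gaps also shows `d ≥ 2`, so that `inf` is ramified and differs from `ξ`.

All of this rests on the local rings at closed points being discrete valuation rings with residue
field `k`, which is deduced from smoothness: the cotangent space is a fibre of the module of
differentials.
-/

/-! ### Smooth local rings of dimension one -/

open IsLocalRing KaehlerDifferential in
/-- A noetherian local domain with residue field `k` that is a localization of a smooth `k`-algebra
of relative dimension one is a discrete valuation ring: its cotangent space is the fibre of the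
module of differentials, which is free of rank one. -/
theorem isDiscreteValuationRing_of_isStandardSmooth (k S B : Type*) [Field k] [CommRing S]
    [Nontrivial S] [CommRing B] [IsDomain B] [IsLocalRing B] [IsNoetherianRing B] [Algebra k S]
    [Algebra S B]
    [Algebra k B] [IsScalarTower k S B]
    [Algebra.IsStandardSmoothOfRelativeDimension 1 k S] (M : Submonoid S) [IsLocalization M B]
    (hk : Function.Surjective (algebraMap k (ResidueField B))) :
    IsDiscreteValuationRing B := by
  have hst : Algebra.IsStandardSmooth k S :=
    Algebra.IsStandardSmoothOfRelativeDimension.isStandardSmooth 1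
  have : Algebra.FormallySmooth S B :=
    Algebra.FormallySmooth.of_isLocalization M
  have : Algebra.FormallyEtale S B :=
    Algebra.FormallyEtale.of_isLocalization M
  have : Algebra.FormallySmooth k B := Algebra.FormallySmooth.comp k S B
  have hbij : Function.Bijective (algebraMap k (ResidueField B)) :=
    ⟨(algebraMap k (ResidueField B)).injective, hk⟩
  have : Algebra.FormallyEtale k (ResidueField B) :=
    Algebra.FormallyEtale.of_equiv (AlgEquiv.ofBijective (Algebra.ofId k (ResidueField B)) hbij)
  have hres : Function.Surjective (algebraMap B (ResidueField B)) := IsLocalRing.residue_surjective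
  have hinj : Function.Injective (kerCotangentToTensor k B (ResidueField B)) :=
    (Algebra.FormallySmooth.kerCotangentToTensor_injective_iff hres).mpr inferInstance
  have hsurj : Function.Surjective (kerCotangentToTensor k B (ResidueField B)) := by
    intro z
    exact (exact_kerCotangentToTensor_mapBaseChange k B (ResidueField B) hres z).mp
      (Subsingleton.elim _ _)
  -- the ideal is generalized because the cotangent space is a dependent type over it
  have key : ∀ I : Ideal B, I = RingHom.ker (algebraMap B (ResidueField B)) →
      Nonempty (I.Cotangent ≃ₗ[B] TensorProduct B (ResidueField B) Ω[B⁄k]) := by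
    rintro _ rfl
    exact ⟨LinearEquiv.ofBijective _ ⟨hinj, hsurj⟩⟩
  obtain ⟨e⟩ := key (maximalIdeal B) IsLocalRing.ker_residue.symm
  let e' : CotangentSpace B ≃ₗ[ResidueField B] TensorProduct B (ResidueField B) Ω[B⁄k] :=
    e.extendScalarsOfSurjective hres
  have hrank : Module.finrank B Ω[B⁄k] = 1 := by
    rw [← (tensorKaehlerEquivOfFormallyEtale k S B).finrank_eq, Module.finrank_baseChange]
    exact Module.finrank_eq_of_rank_eq
      (Algebra.IsStandardSmoothOfRelativeDimension.rank_kaehlerDifferential (R := k) 1)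
  have : Module.Free B Ω[B⁄k] :=
    Module.Free.of_equiv (tensorKaehlerEquivOfFormallyEtale k S B)
  rw [← finrank_CotangentSpace_eq_one_iff, e'.finrank_eq, Module.finrank_baseChange, hrank]

/-! ### Local rings of the curve at closed points -/

namespace SmoothProperCurve

variable {k : Type u} [Field k] (C : SmoothProperCurve k)

/-- The structure map from `k` to the sections of the structure sheaf over an open set. -/
noncomputable def structureMap (U : C.X.Opens) : k →+* Γ(C.X, U) :=
  ((Scheme.ΓSpecIso (CommRingCat.of k)).inv ≫ C.str.appTop ≫
    C.X.presheaf.map (homOfLE le_top).op).hom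

/-- The local ring at a point, as a `k`-algebra. -/
@[reducible] noncomputable def stalkAlgebra (x : C.X) : Algebra k (C.X.presheaf.stalk x) :=
  ((C.X.presheaf.germ ⊤ x (TopologicalSpace.Opens.mem_top x)).hom.comp (C.structureMap ⊤)).toAlgebra

theorem germ_structureMap (U : C.X.Opens) (x : C.X) (hx : x ∈ U) (c : k) :
    C.X.presheaf.germ U x hx (C.structureMap U c) =
      C.X.presheaf.germ ⊤ x (TopologicalSpace.Opens.mem_top x) (C.structureMap ⊤ c) := by
  have : ∀ (V : C.X.Opens) (hV : x ∈ V), (C.structureMap V) c =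
      C.X.presheaf.map (homOfLE le_top).op
        (((Scheme.ΓSpecIso (CommRingCat.of k)).inv ≫ C.str.appTop).hom c) := by
    intro V hV
    simp [structureMap]
  rw [this U hx, this ⊤ (TopologicalSpace.Opens.mem_top x), TopCat.Presheaf.germ_res_apply,
    TopCat.Presheaf.germ_res_apply]

theorem algebraMap_eq_germ (c : k) :
    algebraMap k C.K c = C.X.germToFunctionField ⊤ (C.structureMap ⊤ c) := by
  have : C.structureMap ⊤ c = ((Scheme.ΓSpecIso (CommRingCat.of k)).inv ≫ C.str.appTop).hom c := by
    simp [structureMap]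
  rw [this]
  rfl

theorem algebraMap_stalk (x : C.X) (c : k) :
    algebraMap (C.X.presheaf.stalk x) C.K
      (C.X.presheaf.germ ⊤ x (TopologicalSpace.Opens.mem_top x) (C.structureMap ⊤ c)) =
      algebraMap k C.K c := by
  rw [Scheme.algebraMap_germ_eq_germToFunctionField, algebraMap_eq_germ]

/-- Mathlib's isomorphism between the residue field at a closed point and `k` is induced by the
structure map. -/
theorem residueFieldIsoBase_inv_apply [IsAlgClosed k] (ξ : C.Point) (c : k) :
    (residueFieldIsoBase C.str ξ.1 ξ.2).inv c =
      C.X.residue ξ.1 (C.X.presheaf.germ ⊤ ξ.1 (TopologicalSpace.Opens.mem_top ξ.1)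
        (C.structureMap ⊤ c)) := by
  have h1 := SpecMap_residueFieldIsoBase_inv C.str ξ.1 ξ.2
  have h2 := Scheme.ΓSpecIso_inv_naturality (residueFieldIsoBase C.str ξ.1 ξ.2).inv
  rw [h1, Scheme.fromSpecResidueField, Category.assoc, Scheme.Hom.comp_appTop,
    Scheme.Hom.comp_appTop, Scheme.fromSpecStalk_appTop] at h2
  have h3 : (residueFieldIsoBase C.str ξ.1 ξ.2).inv =
      CommRingCat.ofHom (C.structureMap ⊤) ≫
        C.X.presheaf.germ ⊤ ξ.1 (TopologicalSpace.Opens.mem_top ξ.1) ≫ C.X.residue ξ.1 := by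
    rw [← cancel_mono (Scheme.ΓSpecIso _).inv, h2]
    have h4 := Scheme.ΓSpecIso_inv_naturality (C.X.residue ξ.1)
    have h5 : (homOfLE (le_top : (⊤ : (Spec (C.X.presheaf.stalk ξ.1)).Opens) ≤ ⊤)) = 𝟙 _ := rfl
    have h6 : (homOfLE (le_top : (⊤ : C.X.Opens) ≤ ⊤)) = 𝟙 _ := rfl
    simp only [Category.assoc, h5, structureMap, h6]
    rw [h4]
    simp
  rw [h3]
  rfl

theorem residue_surjective [IsAlgClosed k] (ξ : C.Point) (r : C.X.residueField ξ.1) :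
    ∃ c : k, C.X.residue ξ.1 (C.X.presheaf.germ ⊤ ξ.1 (TopologicalSpace.Opens.mem_top ξ.1)
      (C.structureMap ⊤ c)) = r := by
  refine ⟨(residueFieldIsoBase C.str ξ.1 ξ.2).hom r, ?_⟩
  rw [← residueFieldIsoBase_inv_apply]
  simp

/-- An affine neighbourhood whose ring of sections is standard smooth over `k`. Mathlib's local
description of smoothness also shrinks the base, which has a single point here. -/
theorem exists_isStandardSmooth (ξ : C.X) : ∃ (V : C.X.Opens) (_ : IsAffineOpen V) (_ : ξ ∈ V),
    (C.structureMap V).IsStandardSmoothOfRelativeDimension 1 := by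
  obtain ⟨U, hU, V, hV, hx, e, h⟩ :=
    SmoothOfRelativeDimension.exists_isStandardSmoothOfRelativeDimension (n := 1) (f := C.str) ξ
  have hU' : U = ⊤ := by
    rw [eq_top_iff]
    intro z _
    have : C.str ξ = z := Subsingleton.elim (α := PrimeSpectrum k) _ _
    exact this ▸ e hx
  subst hU'
  refine ⟨V, hV, hx, ?_⟩
  have h1 := h.comp (RingHom.IsStandardSmoothOfRelativeDimension.equiv
    (Scheme.ΓSpecIso (CommRingCat.of k)).symm.commRingCatIsoToRingEquiv)
  rw [add_zero] at h1
  convert! h1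

instance isDiscreteValuationRing_stalk [IsAlgClosed k] (ξ : C.Point) :
    IsDiscreteValuationRing (C.X.presheaf.stalk ξ.1) := by
  obtain ⟨V, hV, hx, h⟩ := C.exists_isStandardSmooth ξ.1
  let _ : Algebra k Γ(C.X, V) := (C.structureMap V).toAlgebra
  let _ : Algebra k (C.X.presheaf.stalk ξ.1) := C.stalkAlgebra ξ.1
  let _ : Algebra Γ(C.X, V) (C.X.presheaf.stalk ξ.1) :=
    TopCat.Presheaf.algebra_section_stalk C.X.presheaf (⟨ξ.1, hx⟩ : V)
  have : IsScalarTower k Γ(C.X, V) (C.X.presheaf.stalk ξ.1) := .of_algebraMap_eq fun c =>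
    (C.germ_structureMap V ξ.1 hx c).symm
  have : Nonempty V := ⟨⟨ξ.1, hx⟩⟩
  have : Algebra.IsStandardSmoothOfRelativeDimension 1 k Γ(C.X, V) := h
  have := hV.isLocalization_stalk ⟨ξ.1, hx⟩
  refine isDiscreteValuationRing_of_isStandardSmooth k Γ(C.X, V) _
    (hV.primeIdealOf ⟨ξ.1, hx⟩).asIdeal.primeCompl ?_
  intro r
  exact C.residue_surjective ξ r

theorem coheight_eq_one [IsAlgClosed k] (ξ : C.Point) : Order.coheight ξ.1 = 1 := by
  have h := ringKrullDim_stalk_eq_coheight ξ.1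
  rw [IsDiscreteValuationRing.ringKrullDim_eq_one] at h
  exact_mod_cast h.symm

end SmoothProperCurve

/-! ### The order of vanishing at a closed point -/

namespace SmoothProperCurve

variable {k : Type u} [Field k] (C : SmoothProperCurve k)

theorem v_zero (ξ : C.Point) : C.v ξ 0 = ⊤ := by simp [v]

theorem v_of_ne_zero (ξ : C.Point) {f : C.K} (hf : f ≠ 0) :
    C.v ξ f = ((Scheme.ord f ξ.1 : ℤ) : WithTop ℤ) := by simp [v, hf]

theorem v_one (ξ : C.Point) : C.v ξ 1 = 0 := by
  rw [v_of_ne_zero _ _ one_ne_zero, ord_one]; rfl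

theorem v_mul (ξ : C.Point) (f g : C.K) : C.v ξ (f * g) = C.v ξ f + C.v ξ g := by
  by_cases hf : f = 0
  · simp [hf, v_zero]
  by_cases hg : g = 0
  · simp [hg, v_zero]
  rw [v_of_ne_zero _ _ hf, v_of_ne_zero _ _ hg, v_of_ne_zero _ _ (mul_ne_zero hf hg),
    Scheme.ord_mul hf hg, WithTop.coe_add]

theorem v_add [IsAlgClosed k] (ξ : C.Point) (f g : C.K) :
    min (C.v ξ f) (C.v ξ g) ≤ C.v ξ (f + g) := by
  by_cases hf : f = 0
  · simp [hf, v_zero]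
  by_cases hg : g = 0
  · simp [hg, v_zero]
  by_cases hfg : f + g = 0
  · simp [hfg, v_zero]
  rw [v_of_ne_zero _ _ hf, v_of_ne_zero _ _ hg, v_of_ne_zero _ _ hfg, ← WithTop.coe_min]
  exact WithTop.coe_le_coe.mpr (Scheme.ord_add hfg)

/-- The order of vanishing at a closed point, as an additive valuation. -/
noncomputable def addVal [IsAlgClosed k] (ξ : C.Point) : AddValuation C.K (WithTop ℤ) :=
  AddValuation.of (C.v ξ) (C.v_zero ξ) (C.v_one ξ) (C.v_add ξ) (C.v_mul ξ)

theorem addVal_apply [IsAlgClosed k] (ξ : C.Point) (f : C.K) : C.addVal ξ f = C.v ξ f := rfl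

theorem ord_eq_iff_ordFrac [IsAlgClosed k] (ξ : C.Point) {f : C.K} (hf : f ≠ 0) {n : ℤ} :
    Scheme.ord f ξ.1 = n ↔ Ring.ordFrac (C.X.presheaf.stalk ξ.1) f = WithZero.exp n :=
  Scheme.ord_eq_iff (C.coheight_eq_one ξ) hf

theorem ord_algebraMap_nonneg [IsAlgClosed k] (ξ : C.Point) {a : C.X.presheaf.stalk ξ.1}
    (ha : a ≠ 0) :
    0 ≤ Scheme.ord (algebraMap (C.X.presheaf.stalk ξ.1) C.K a) ξ.1 := by
  have hne : algebraMap (C.X.presheaf.stalk ξ.1) C.K a ≠ 0 := by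
    simpa using ha
  rw [Scheme.le_ord_iff (C.coheight_eq_one ξ) hne]
  exact Ring.ordFrac_ge_one_of_ne_zero ha

theorem isUnit_iff_ord_eq_zero [IsAlgClosed k] (ξ : C.Point) {a : C.X.presheaf.stalk ξ.1}
    (ha : a ≠ 0) :
    IsUnit a ↔ Scheme.ord (algebraMap (C.X.presheaf.stalk ξ.1) C.K a) ξ.1 = 0 := by
  have hne : algebraMap (C.X.presheaf.stalk ξ.1) C.K a ≠ 0 := by
    simpa using ha
  rw [ord_eq_iff_ordFrac _ _ hne]
  exact Ring.isUnit_iff_ordFrac_one_of_isDiscreteValuationRing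

/-- The local ring at a closed point is the valuation ring of the order of vanishing. -/
theorem mem_localRing_iff [IsAlgClosed k] (ξ : C.Point) (f : C.K) :
    f ∈ C.localRing ξ ↔ 0 ≤ C.v ξ f := by
  by_cases hf : f = 0
  · simp [hf, v_zero]
  constructor
  · rintro ⟨a, rfl⟩
    rw [v_of_ne_zero _ _ hf]
    have ha : a ≠ 0 := fun h => hf (by rw [h, map_zero])
    exact_mod_cast C.ord_algebraMap_nonneg ξ ha
  · intro h
    rw [v_of_ne_zero _ _ hf] at h
    have h0 : 0 ≤ Scheme.ord f ξ.1 := by exact_mod_cast h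
    rcases ValuationRing.isInteger_or_isInteger (C.X.presheaf.stalk ξ.1) f with ⟨a, ha⟩ | ⟨a, ha⟩
    · exact ⟨a, ha⟩
    · have ha0 : a ≠ 0 := by
        rintro rfl
        rw [map_zero] at ha
        exact inv_ne_zero hf ha.symm
      have h1 := C.ord_algebraMap_nonneg ξ ha0
      have hu := C.isUnit_iff_ord_eq_zero ξ ha0
      rw [ha, ord_inv _ _ hf] at h1 hu
      obtain ⟨u, rfl⟩ := hu.mpr (by omega)
      refine ⟨((u⁻¹ : (C.X.presheaf.stalk ξ.1)ˣ) : C.X.presheaf.stalk ξ.1), ?_⟩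
      have : algebraMap (C.X.presheaf.stalk ξ.1) C.K
          ((u⁻¹ : (C.X.presheaf.stalk ξ.1)ˣ) : C.X.presheaf.stalk ξ.1) * f⁻¹ = 1 := by
        rw [← ha, ← map_mul, Units.inv_mul, map_one]
      rwa [mul_inv_eq_one₀ hf] at this

theorem v_algebraMap [IsAlgClosed k] (ξ : C.Point) {c : k} (hc : c ≠ 0) :
    C.v ξ (algebraMap k C.K c) = 0 := by
  have hne : algebraMap k C.K c ≠ 0 := by simpa using hc
  have hne' : C.X.presheaf.germ ⊤ ξ.1 (TopologicalSpace.Opens.mem_top _) (C.structureMap ⊤ c) ≠ 0 :=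
    fun h => hne (by rw [← C.algebraMap_stalk ξ.1, h, map_zero])
  rw [v_of_ne_zero _ _ hne, ← C.algebraMap_stalk ξ.1, (C.isUnit_iff_ord_eq_zero ξ hne').mp]
  · rfl
  · exact ((isUnit_iff_ne_zero.mpr hc).map (C.structureMap ⊤)).map
      (C.X.presheaf.germ ⊤ ξ.1 (TopologicalSpace.Opens.mem_top _)).hom

theorem v_algebraMap_nonneg [IsAlgClosed k] (ξ : C.Point) (c : k) :
    0 ≤ C.v ξ (algebraMap k C.K c) := by
  by_cases hc : c = 0
  · simp [hc, v_zero]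
  · rw [v_algebraMap _ _ hc]

/-- A function that is regular at a closed point takes a value in `k` there. -/
theorem exists_one_le_v_sub [IsAlgClosed k] (ξ : C.Point) {f : C.K} (hf : 0 ≤ C.v ξ f) :
    ∃ c : k, 1 ≤ C.v ξ (f - algebraMap k C.K c) := by
  obtain ⟨a, rfl⟩ := (C.mem_localRing_iff ξ f).mpr hf
  obtain ⟨c, hc⟩ := C.residue_surjective ξ (C.X.residue ξ.1 a)
  refine ⟨c, ?_⟩
  rw [← C.algebraMap_stalk ξ.1, ← map_sub]
  set b := a - C.X.presheaf.germ ⊤ ξ.1 (TopologicalSpace.Opens.mem_top _)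
    (C.structureMap ⊤ c) with hb
  by_cases hb0 : b = 0
  · simp [hb0, v_zero]
  have hr : IsLocalRing.residue _ b = 0 := by
    rw [hb, map_sub, sub_eq_zero]
    exact hc.symm
  have hu : ¬ IsUnit b := by
    rw [IsLocalRing.residue_eq_zero_iff] at hr
    exact hr
  rw [C.isUnit_iff_ord_eq_zero ξ hb0] at hu
  have := C.ord_algebraMap_nonneg ξ hb0
  rw [v_of_ne_zero _ _ (by simpa using hb0)]
  have : (1 : ℤ) ≤ Scheme.ord (algebraMap (C.X.presheaf.stalk ξ.1) C.K b) ξ.1 := by omega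
  exact_mod_cast this

theorem exists_v_eq_one [IsAlgClosed k] (ξ : C.Point) : ∃ t : C.K, C.v ξ t = 1 := by
  obtain ⟨ϖ, h⟩ := IsDiscreteValuationRing.exists_irreducible (C.X.presheaf.stalk ξ.1)
  have hne : algebraMap (C.X.presheaf.stalk ξ.1) C.K ϖ ≠ 0 := by simpa using h.ne_zero
  refine ⟨algebraMap _ C.K ϖ, ?_⟩
  rw [v_of_ne_zero _ _ hne, (C.ord_eq_iff_ordFrac ξ hne (n := 1)).mpr (Ring.ordFrac_irreducible h)]
  rfl

/-- A rational function has finitely many poles: as the closed points have codimension one, a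
proper closed irreducible subset contains only one of them. -/
theorem finite_setOf_notMem_localRing [IsAlgClosed k] (f : C.K) :
    {ξ : C.Point | f ∉ C.localRing ξ}.Finite := by
  obtain ⟨U, hU, s, hs⟩ := C.X.presheaf.exists_germ_eq f
  have hne : Nonempty U := ⟨⟨_, hU⟩⟩
  have : CompactSpace C.X := (quasiCompact_iff_compactSpace C.str).mp inferInstance
  have hnoeth : IsNoetherian C.X := {}
  obtain ⟨S, hS, hSc, hSi, hSU⟩ :=
    TopologicalSpace.NoetherianSpace.exists_finite_set_isClosed_irreducible
      U.isOpen.isClosed_compl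
  have hsub : {ξ : C.Point | f ∉ C.localRing ξ} ⊆ ⋃ Z ∈ S, {ξ : C.Point | ξ.1 ∈ Z} := by
    intro ξ hξ
    have hξU : ξ.1 ∈ (U : Set C.X)ᶜ := by
      intro hmem
      exact hξ ⟨C.X.presheaf.germ U ξ.1 hmem s, by
        rw [Scheme.algebraMap_germ_eq_germToFunctionField]; exact hs⟩
    rw [hSU] at hξU
    simpa using hξU
  refine (hS.biUnion fun Z hZ => Set.Subsingleton.finite ?_).subset hsub
  -- every closed point of `Z` equals the generic point `η` of `Z`
  obtain ⟨η, hη⟩ := QuasiSober.sober (hSi Z hZ) (hSc Z hZ)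
  have key : ∀ ξ : C.Point, ξ.1 ∈ Z → ξ.1 = η := by
    intro ξ hξ
    have h1 : ξ.1 ≤ η := hη.specializes hξ
    have h2 : η < genericPoint C.X := by
      refine lt_of_le_not_ge ((genericPoint_spec C.X).specializes trivial) fun h => ?_
      have h3 : η ∈ U := Specializes.mem_open h U.isOpen hU
      have h4 : η ∈ (U : Set C.X)ᶜ := by
        rw [hSU]
        exact ⟨Z, hZ, hη.mem⟩
      exact h4 h3
    by_contra hne
    have h5 : ξ.1 < η := by
      refine lt_of_le_not_ge h1 fun h => hne ?_
      have := Specializes.mem_closed h ξ.2 rfl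
      exact this.symm
    have h6 := Order.coheight_add_one_le h5
    have h7 := Order.coheight_add_one_le h2
    rw [C.coheight_eq_one ξ] at h6
    have h8 : Order.coheight η = 0 := by
      have : Order.coheight η + 1 ≤ 0 + 1 := by simpa using h6
      simpa using (ENat.add_le_add_iff_right ENat.one_ne_top).mp this
    rw [h8] at h7
    simp at h7
  intro a ha b hb
  exact Subtype.ext ((key a ha).trans (key b hb).symm)

/-- A rational function without poles is constant. -/
theorem exists_eq_algebraMap_of_forall_mem_localRing [IsAlgClosed k] {f : C.K}
    (hf : ∀ ξ, f ∈ C.localRing ξ) : ∃ c : k, f = algebraMap k C.K c := by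
  have : CompactSpace C.X := (quasiCompact_iff_compactSpace C.str).mp inferInstance
  -- The germs of `f` glue to a global section: the set of points near which `f` is regular is open
  -- and contains all closed points.
  let P : C.X → Prop := fun z => ∃ (U : C.X.Opens) (hU : z ∈ U) (hg : genericPoint C.X ∈ U)
    (s : Γ(C.X, U)), C.X.presheaf.germ U (genericPoint C.X) hg s = f
  have hopen : IsOpen {z | P z} := by
    rw [isOpen_iff_forall_mem_open]
    rintro z ⟨U, hU, hg, s, hs⟩
    exact ⟨U, fun w hw => ⟨U, hw, hg, s, hs⟩, U.isOpen, hU⟩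
  have hP : ∀ z, P z := by
    by_contra! hz
    obtain ⟨z, hz⟩ := hz
    obtain ⟨ξ, hξ, hcl⟩ := IsClosed.exists_closed_singleton hopen.isClosed_compl ⟨z, hz⟩
    obtain ⟨a, ha⟩ := hf ⟨ξ, hcl⟩
    obtain ⟨U, hU, s, rfl⟩ := C.X.presheaf.exists_germ_eq a
    have : Nonempty U := ⟨⟨_, hU⟩⟩
    rw [Scheme.algebraMap_germ_eq_germToFunctionField] at ha
    exact hξ ⟨U, hU, _, s, ha⟩
  choose U hU hg s hs using hP
  obtain ⟨g, hg', -⟩ := TopCat.Sheaf.existsUnique_gluing' C.X.sheaf U ⊤ (fun i => homOfLE le_top)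
    (fun z _ => TopologicalSpace.Opens.mem_iSup.mpr ⟨z, hU z⟩) s (by
      intro i j
      have hm : genericPoint C.X ∈ U i ⊓ U j := ⟨hg i, hg j⟩
      apply germ_injective_of_isIntegral C.X (genericPoint C.X) hm
      erw [TopCat.Presheaf.germ_res_apply, TopCat.Presheaf.germ_res_apply]
      rw [hs, hs])
  have hgf : C.X.germToFunctionField ⊤ g = f := by
    have z := genericPoint C.X
    rw [← hs z, ← hg' z]
    exact (TopCat.Presheaf.germ_res_apply ..).symm
  -- by properness the global sections are integral over `k`, which is algebraically closed
  have hint : (C.structureMap ⊤).IsIntegral := by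
    have h1 := isIntegral_appTop_of_universallyClosed C.str
    have h2 := RingHom.isIntegral_of_surjective
      (Scheme.ΓSpecIso (CommRingCat.of k)).symm.commRingCatIsoToRingEquiv.toRingHom
      (Scheme.ΓSpecIso (CommRingCat.of k)).symm.commRingCatIsoToRingEquiv.surjective
    have h3 := h2.trans _ _ h1
    convert! h3 using 1
    simp only [structureMap]
    have h6 : (homOfLE (le_top : (⊤ : C.X.Opens) ≤ ⊤)) = 𝟙 _ := rfl
    rw [h6]
    simp
    rfl
  obtain ⟨c, hc⟩ := IsAlgClosed.ringHom_bijective_of_isIntegral _ hint |>.2 g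
  exact ⟨c, by rw [algebraMap_eq_germ, hc, hgf]⟩

/-- The local ring at a closed point is essentially of finite type over `k`. -/
theorem exists_finset_adjoin_localRing [IsAlgClosed k] (ξ : C.Point) : ∃ S : Finset C.K,
    (∀ z ∈ S, 0 ≤ C.v ξ z) ∧ ∀ f, 0 ≤ C.v ξ f → ∃ a ∈ Algebra.adjoin k (S : Set C.K),
      ∃ b ∈ Algebra.adjoin k (S : Set C.K), C.v ξ b = 0 ∧ f * b = a := by
  classical
  obtain ⟨V, hV, hx, h⟩ := C.exists_isStandardSmooth ξ.1
  have : Nonempty V := ⟨⟨ξ.1, hx⟩⟩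
  let _ : Algebra k Γ(C.X, V) := (C.structureMap V).toAlgebra
  let _ : Algebra Γ(C.X, V) (C.X.presheaf.stalk ξ.1) :=
    TopCat.Presheaf.algebra_section_stalk C.X.presheaf (⟨ξ.1, hx⟩ : V)
  have : Algebra.IsStandardSmoothOfRelativeDimension 1 k Γ(C.X, V) := h
  have : Algebra.IsStandardSmooth k Γ(C.X, V) :=
    Algebra.IsStandardSmoothOfRelativeDimension.isStandardSmooth 1
  have hft : Algebra.FiniteType k Γ(C.X, V) := inferInstance
  have hloc := hV.isLocalization_stalk ⟨ξ.1, hx⟩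
  have hgerm : ∀ s : Γ(C.X, V), C.X.germToFunctionField V s =
      algebraMap (C.X.presheaf.stalk ξ.1) C.K (algebraMap Γ(C.X, V) (C.X.presheaf.stalk ξ.1) s) :=
    fun s => (Scheme.algebraMap_germ_eq_germToFunctionField C.X hx s).symm
  let φ : Γ(C.X, V) →ₐ[k] C.K :=
    { (C.X.germToFunctionField V).hom with
      commutes' := fun c => by
        refine (hgerm _).trans ?_
        rw [← C.algebraMap_stalk ξ.1, ← C.germ_structureMap V ξ.1 hx]
        rfl }
  have hφ : ∀ s, φ s = algebraMap (C.X.presheaf.stalk ξ.1) C.K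
      (algebraMap Γ(C.X, V) (C.X.presheaf.stalk ξ.1) s) := hgerm
  obtain ⟨S, hS⟩ := hft.out
  refine ⟨S.image φ, ?_, ?_⟩
  · intro z hz
    obtain ⟨s, -, rfl⟩ := Finset.mem_image.mp hz
    rw [← mem_localRing_iff, hφ]
    exact ⟨_, rfl⟩
  · intro f hf
    obtain ⟨a, rfl⟩ := (C.mem_localRing_iff ξ f).mpr hf
    have hadj : ∀ s, φ s ∈ Algebra.adjoin k ((S.image φ : Finset C.K) : Set C.K) := by
      intro s
      rw [Finset.coe_image, ← AlgHom.map_adjoin, hS]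
      exact ⟨s, trivial, rfl⟩
    obtain ⟨⟨s, t⟩, hst⟩ := IsLocalization.surj
      (hV.primeIdealOf ⟨ξ.1, hx⟩).asIdeal.primeCompl a
    refine ⟨φ s, hadj s, φ t, hadj t, ?_, ?_⟩
    · have hu : IsUnit (algebraMap Γ(C.X, V) (C.X.presheaf.stalk ξ.1) t) :=
        IsLocalization.map_units _ t
      rw [hφ, v_of_ne_zero _ _ (by simpa using hu.ne_zero),
        (C.isUnit_iff_ord_eq_zero ξ hu.ne_zero).mp hu]
      rfl
    · rw [hφ, hφ, ← map_mul]
      exact congrArg _ hst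

end SmoothProperCurve

/-! ### Hasse-Schmidt derivatives and orders of vanishing -/

theorem WithTop.coe_le_add_of_le {a b : WithTop ℤ} {m n p : ℤ} (ha : (m : WithTop ℤ) ≤ a)
    (hb : (n : WithTop ℤ) ≤ b) (h : p ≤ m + n) : (p : WithTop ℤ) ≤ a + b :=
  (WithTop.coe_le_coe.mpr h).trans (by rw [WithTop.coe_add]; exact add_le_add ha hb)

namespace IsStandardHasseSchmidt

variable {k F : Type*} [Field k] [Field F] [Algebra k F] {x : F} {D : ℕ → F →ₗ[k] F}

theorem map_one (hD : IsStandardHasseSchmidt k x D) (n : ℕ) : D n 1 = if n = 0 then 1 else 0 := by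
  have := hD.pow 0 n
  rw [pow_zero] at this
  rw [this]
  rcases n with _ | n <;> simp

theorem map_algebraMap (hD : IsStandardHasseSchmidt k x D) (n : ℕ) (c : k) :
    D n (algebraMap k F c) = if n = 0 then algebraMap k F c else 0 := by
  rw [Algebra.algebraMap_eq_smul_one, map_smul, hD.map_one]
  split <;> simp

theorem map_sub_algebraMap (hD : IsStandardHasseSchmidt k x D) (n : ℕ) (c : k) :
    D n (x - algebraMap k F c) =
      if n = 0 then x - algebraMap k F c else if n = 1 then 1 else 0 := by
  have h := hD.pow 1 n
  rw [pow_one] at h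
  rw [map_sub, h, hD.map_algebraMap]
  rcases n with _ | _ | n
  · simp
  · simp
  · simp [Nat.choose_eq_zero_of_lt]

variable (w : AddValuation F (WithTop ℤ))

theorem le_map_mul (hD : IsStandardHasseSchmidt k x D) {n : ℕ} {f g : F} {m : WithTop ℤ}
    (h : ∀ i j, i + j = n → m ≤ w (D i f) + w (D j g)) : m ≤ w (D n (f * g)) := by
  rw [hD.leibniz]
  refine w.map_le_sum fun ij hij => ?_
  rw [w.map_mul]
  exact h _ _ (Finset.HasAntidiagonal.mem_antidiagonal.mp hij)

/-- The functions whose first `n` Hasse-Schmidt derivatives have poles whose orders grow at most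
linearly, with slope `B`. -/
def bounded (hD : IsStandardHasseSchmidt k x D) (hk : ∀ c : k, 0 ≤ w (algebraMap k F c))
    (n B : ℕ) : Subalgebra k F where
  carrier := {f | ∀ b ≤ n, ((-(B * b : ℤ) : ℤ) : WithTop ℤ) ≤ w (D b f)}
  add_mem' := fun {f g} hf hg b hb => by
    rw [map_add]
    exact w.map_le_add (hf b hb) (hg b hb)
  mul_mem' := fun {f g} hf hg b hb => by
    refine hD.le_map_mul w fun i j hij => ?_
    refine WithTop.coe_le_add_of_le (hf i (by omega)) (hg j (by omega)) ?_
    rw [← hij]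
    push_cast
    linarith
  algebraMap_mem' := fun c b _ => by
    rw [hD.map_algebraMap]
    split
    · rename_i h
      subst h
      simpa using hk c
    · simp

/-- The algebra `bounded` is closed under division by its elements that are units of the valuation
ring: solve the Leibniz rule for `D m (f * b)` for `D m f`. -/
theorem mem_bounded_of_mul (hD : IsStandardHasseSchmidt k x D)
    (hk : ∀ c : k, 0 ≤ w (algebraMap k F c)) {n B : ℕ} {f a b : F}
    (ha : a ∈ hD.bounded w hk n B) (hb : b ∈ hD.bounded w hk n B) (hw : w b = 0)
    (hfb : f * b = a) : f ∈ hD.bounded w hk n B := by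
  intro m
  induction m using Nat.strong_induction_on with
  | _ m ih =>
    intro hm
    have h1 := hD.leibniz m f b
    rw [Finset.Nat.sum_antidiagonal_eq_sum_range_succ (fun i j => D i f * D j b),
      Finset.sum_range_succ, Nat.sub_self, hD.zero, hfb] at h1
    have h2 : w (D m f) = w (D m a - ∑ i ∈ Finset.range m, D i f * D (m - i) b) := by
      rw [h1, add_sub_cancel_left, w.map_mul, hw, add_zero]
    rw [h2]
    refine w.map_le_sub (ha m hm) (w.map_le_sum fun i hi => ?_)
    have hi' := Finset.mem_range.mp hi
    rw [w.map_mul]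
    refine WithTop.coe_le_add_of_le (ih i hi' (by omega)) (hb (m - i) (by omega)) ?_
    rw [Nat.cast_sub hi'.le]
    linarith

theorem le_map_sub_pow (hD : IsStandardHasseSchmidt k x D) {c : k}
    (hc : w (x - algebraMap k F c) = 1) (m n : ℕ) :
    ((m - n : ℤ) : WithTop ℤ) ≤ w (D n ((x - algebraMap k F c) ^ m)) := by
  induction m generalizing n with
  | zero =>
    rw [pow_zero, hD.map_one]
    split
    · rename_i h
      simp [h]
    · simp
  | succ m ih =>
    rw [pow_succ]
    refine hD.le_map_mul w fun i j hij => ?_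
    rw [hD.map_sub_algebraMap]
    split_ifs with h1 h2
    · refine WithTop.coe_le_add_of_le (ih i) (n := 1) (by rw [hc]; rfl) ?_
      push_cast
      omega
    · refine WithTop.coe_le_add_of_le (ih i) (n := 0) (by simp) ?_
      push_cast
      omega
    · simp

/-- Let `w` be a discrete valuation of `F / k` with residue field `k`, whose valuation ring is
essentially of finite type over `k` and for which `x - c` is a uniformizer. The derivatives `D n`
preserve the valuation ring: the denominators of `D n` are bounded on this ring by finite type, and
modulo a high power of the uniformizer each element is a polynomial in `x - c`. -/
theorem map_nonneg (hD : IsStandardHasseSchmidt k x D) (hk : ∀ c : k, 0 ≤ w (algebraMap k F c))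
    (hres : ∀ f, 0 ≤ w f → ∃ c : k, 1 ≤ w (f - algebraMap k F c))
    (S : Finset F) (hS : ∀ f, 0 ≤ w f → ∃ a ∈ Algebra.adjoin k (S : Set F),
      ∃ b ∈ Algebra.adjoin k (S : Set F), w b = 0 ∧ f * b = a) (hS0 : ∀ z ∈ S, 0 ≤ w z)
    {c : k} (hc : w (x - algebraMap k F c) = 1) {f : F} (hf : 0 ≤ w f) (n : ℕ) :
    0 ≤ w (D n f) := by
  classical
  set t := x - algebraMap k F c with ht
  have hw0 : ∀ f : F, f ≠ 0 → ∃ m : ℤ, w f = m := fun f hf =>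
    ⟨_, (WithTop.coe_untop _ ((w.top_iff).not.mpr hf)).symm⟩
  -- a common bound for the denominators of `D 0`, …, `D n` on the valuation ring
  have hbd : ∃ B : ℕ, ∀ f, 0 ≤ w f → f ∈ hD.bounded w hk n B := by
    have h1 : ∀ z : F, ∃ B : ℕ, ∀ b ≤ n, ((-B : ℤ) : WithTop ℤ) ≤ w (D b z) := by
      intro z
      have h2 : ∀ b : ℕ, ∃ B : ℕ, ((-B : ℤ) : WithTop ℤ) ≤ w (D b z) := by
        intro b
        by_cases h0 : D b z = 0
        · exact ⟨0, by simp [h0]⟩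
        · obtain ⟨m, hm⟩ := hw0 _ h0
          refine ⟨m.natAbs, ?_⟩
          rw [hm]
          exact WithTop.coe_le_coe.mpr (by omega)
      choose B hB using h2
      refine ⟨∑ b ∈ Finset.range (n + 1), B b,
        fun b hb => le_trans (WithTop.coe_le_coe.mpr ?_) (hB b)⟩
      have := Finset.single_le_sum (s := Finset.range (n + 1)) (f := B)
        (fun _ _ => Nat.zero_le _) (Finset.mem_range.mpr (Nat.lt_succ_of_le hb))
      omega
    choose B hB using h1
    refine ⟨∑ z ∈ S, B z, fun f hf => ?_⟩
    have hadj : Algebra.adjoin k (S : Set F) ≤ hD.bounded w hk n (∑ z ∈ S, B z) := by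
      refine Algebra.adjoin_le fun z hz b hb => ?_
      rcases Nat.eq_zero_or_pos b with rfl | hb0
      · simpa [hD.zero] using hS0 z hz
      · refine le_trans (WithTop.coe_le_coe.mpr ?_) (hB z b hb)
        have h3 := Finset.single_le_sum (f := B) (fun _ _ => Nat.zero_le _) hz
        have h4 : (∑ z ∈ S, B z) ≤ (∑ z ∈ S, B z) * b := Nat.le_mul_of_pos_right _ hb0
        have h5 : B z ≤ (∑ z ∈ S, B z) * b := h3.trans h4
        rw [neg_le_neg_iff]
        exact_mod_cast h5
    obtain ⟨a, ha, b, hb, hb0, hab⟩ := hS f hf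
    exact hD.mem_bounded_of_mul w hk (hadj ha) (hadj hb) hb0 hab
  have ht0 : t ≠ 0 := by
    intro h
    rw [h, w.map_zero] at hc
    exact WithTop.top_ne_one hc
  have htB : t ∈ hD.bounded w hk n 0 := by
    intro b _
    rw [hD.map_sub_algebraMap]
    split_ifs
    · rw [← ht, hc]
      simp
    · simp
    · simp
  -- expansion of `f` in powers of the uniformizer `t`, with a remainder of order at least `M`
  have hexp : ∀ M : ℕ, ∀ f, 0 ≤ w f →
      ∃ p ∈ hD.bounded w hk n 0, ∃ g, 0 ≤ w g ∧ f = p + t ^ M * g := by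
    intro M
    induction M with
    | zero => exact fun f hf => ⟨0, zero_mem _, f, hf, by simp⟩
    | succ M ih =>
      intro f hf
      obtain ⟨p, hp, g, hg, rfl⟩ := ih f hf
      obtain ⟨e, he⟩ := hres g hg
      refine ⟨p + t ^ M * algebraMap k F e, add_mem hp (mul_mem (pow_mem htB M)
        (Subalgebra.algebraMap_mem _ e)), (g - algebraMap k F e) / t, ?_, ?_⟩
      · by_cases h0 : (g - algebraMap k F e) / t = 0
        · simp [h0]
        · obtain ⟨m, hm⟩ := hw0 _ h0
          have h1 : w (g - algebraMap k F e) = w ((g - algebraMap k F e) / t) + 1 := by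
            rw [← hc, ← w.map_mul, div_mul_cancel₀ _ ht0]
          rw [h1, hm] at he
          rw [hm]
          have h2 : (1 : ℤ) ≤ m + 1 := by exact_mod_cast he
          have h3 : (0 : ℤ) ≤ m := by omega
          exact_mod_cast h3
      · field_simp
        ring
  obtain ⟨B, hB⟩ := hbd
  -- `D i (t ^ M)` has order at least `M - n` and `D j g` has order at least `- B * n`
  obtain ⟨p, hp, g, hg, rfl⟩ := hexp (n + B * n) f hf
  rw [map_add]
  refine w.map_le_add ?_ (hD.le_map_mul w fun i j hij => ?_)
  · simpa using hp n le_rfl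
  · refine WithTop.coe_le_add_of_le (hD.le_map_sub_pow w hc (n + B * n) i)
      (hB g hg j (by omega)) (p := 0) ?_
    have h1 : B * j ≤ B * n := Nat.mul_le_mul_left _ (by omega)
    have h2 : (B * j : ℤ) ≤ B * n := by exact_mod_cast h1
    push_cast
    have h3 : (i : ℤ) ≤ n := by omega
    linarith

/-- Write an element of order at least `m` as `(x - c) ^ m * g`: by the Leibniz rule and
`map_nonneg`, the derivative `D n` lowers its order by at most `n`. -/
theorem sub_le_map (hD : IsStandardHasseSchmidt k x D) (hk : ∀ c : k, 0 ≤ w (algebraMap k F c))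
    (hres : ∀ f, 0 ≤ w f → ∃ c : k, 1 ≤ w (f - algebraMap k F c))
    (S : Finset F) (hS : ∀ f, 0 ≤ w f → ∃ a ∈ Algebra.adjoin k (S : Set F),
      ∃ b ∈ Algebra.adjoin k (S : Set F), w b = 0 ∧ f * b = a) (hS0 : ∀ z ∈ S, 0 ≤ w z)
    {c : k} (hc : w (x - algebraMap k F c) = 1) {f : F} {m : ℕ} (hf : (m : WithTop ℤ) ≤ w f)
    (n : ℕ) : ((m - n : ℤ) : WithTop ℤ) ≤ w (D n f) := by
  set t := x - algebraMap k F c with ht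
  have ht0 : t ≠ 0 := by
    intro h
    rw [h, w.map_zero] at hc
    exact WithTop.top_ne_one hc
  obtain ⟨g, rfl⟩ : ∃ g, f = t ^ m * g := ⟨f / t ^ m, by field_simp⟩
  have hg : 0 ≤ w g := by
    rw [w.map_mul, w.map_pow, hc, nsmul_one] at hf
    by_cases h0 : w g = ⊤
    · simp [h0]
    · obtain ⟨e, he⟩ := WithTop.ne_top_iff_exists.mp h0
      rw [← he] at hf ⊢
      have h1 : (m : ℤ) ≤ m + e := by exact_mod_cast hf
      have h2 : (0 : ℤ) ≤ e := by omega
      exact_mod_cast h2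
  refine hD.le_map_mul w fun i j hij => ?_
  exact WithTop.coe_le_add_of_le (hD.le_map_sub_pow w hc m i) (n := 0)
    (hD.map_nonneg w hk hres S hS hS0 hc hg j) (by omega)

end IsStandardHasseSchmidt

namespace SmoothProperCurve

variable {k : Type u} [Field k] [IsAlgClosed k] (C : SmoothProperCurve k)

/-- A function with a pole is transcendental over the field of constants. -/
theorem transcendental_of_v_neg {ξ : C.Point} {x : C.K} (hx : C.v ξ x < 0) :
    Transcendental k x := by
  intro h
  obtain ⟨c, rfl⟩ := minpoly.mem_range_of_degree_eq_one k x
    (IsAlgClosed.degree_eq_one_of_irreducible k (minpoly.irreducible h.isIntegral))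
  exact absurd hx (not_lt.mpr (C.v_algebraMap_nonneg ξ c))

theorem isStandardHasseSchmidt_hasseSchmidt {ξ : C.Point} {x : C.K} (hx : C.v ξ x < 0)
    (hsep : Algebra.IsSeparable (IntermediateField.adjoin k {x}) C.K) :
    IsStandardHasseSchmidt k x (hasseSchmidt k x : ℕ → C.K →ₗ[k] C.K) := by
  have h := (existsUnique_isStandardHasseSchmidt (C.transcendental_of_v_neg hx) hsep).exists
  rw [hasseSchmidt, dif_pos h]
  exact h.choose_spec

/-- At a point where `x - c` is a uniformizer, the `n`-th Hasse-Schmidt derivative lowers the order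
of vanishing of a regular function by at most `n`, and it preserves regularity. -/
theorem le_v_hasseSchmidt {ξ₀ ξ : C.Point} {x : C.K} (hx : C.v ξ₀ x < 0)
    (hsep : Algebra.IsSeparable (IntermediateField.adjoin k {x}) C.K) {c : k}
    (hc : C.v ξ (x - algebraMap k C.K c) = 1) {f : C.K} {m : ℕ} (hf : (m : WithTop ℤ) ≤ C.v ξ f)
    (n : ℕ) : ((m - n : ℤ) : WithTop ℤ) ≤ C.v ξ (hasseSchmidt k x n f) ∧
      0 ≤ C.v ξ (hasseSchmidt k x n f) := by
  obtain ⟨S, hS0, hS⟩ := C.exists_finset_adjoin_localRing ξ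
  have hD := C.isStandardHasseSchmidt_hasseSchmidt hx hsep
  have hf0 : 0 ≤ C.v ξ f := le_trans (WithTop.coe_le_coe.mpr (Int.natCast_nonneg m)) hf
  exact ⟨hD.sub_le_map (C.addVal ξ) (C.v_algebraMap_nonneg ξ)
      (fun f hf => C.exists_one_le_v_sub ξ hf) S hS hS0 hc hf n,
    hD.map_nonneg (C.addVal ξ) (C.v_algebraMap_nonneg ξ)
      (fun f hf => C.exists_one_le_v_sub ξ hf) S hS hS0 hc hf0 n⟩

end SmoothProperCurve

/-! ### Functions regular away from one point -/

namespace SmoothProperCurve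

variable {k : Type u} [Field k] {C : SmoothProperCurve k}

theorem mem_affineRing {inf : C.Point} {f : C.K} :
    f ∈ C.affineRing inf ↔ ∀ ξ ≠ inf, f ∈ C.localRing ξ := by
  simp [affineRing, Submodule.mem_iInf]

variable [IsAlgClosed k]

variable (C) in
/-- Subtracting a suitable constant multiple of `g` kills the leading term of `f`. -/
theorem exists_lt_v_sub_smul (ξ : C.Point) {f g : C.K} {m : ℤ} (hf : C.v ξ f = m)
    (hg : C.v ξ g = m) : ∃ c : k, c ≠ 0 ∧ ((m + 1 : ℤ) : WithTop ℤ) ≤ C.v ξ (f - c • g) := by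
  have hg0 : g ≠ 0 := by
    rintro rfl
    rw [v_zero] at hg
    exact WithTop.top_ne_coe hg
  have h1 : C.v ξ (f / g) = 0 := by
    have h2 : C.v ξ (f / g) + C.v ξ g = C.v ξ f := by rw [← v_mul, div_mul_cancel₀ _ hg0]
    rw [hf, hg] at h2
    have h3 : C.v ξ (f / g) + m = 0 + m := by rw [h2, zero_add]
    exact (WithTop.add_right_inj WithTop.coe_ne_top).mp h3
  obtain ⟨c, hc⟩ := C.exists_one_le_v_sub ξ h1.ge
  refine ⟨c, ?_, ?_⟩
  · rintro rfl
    rw [map_zero, sub_zero, h1] at hc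
    exact absurd hc (by decide)
  · have h2 : f - c • g = (f / g - algebraMap k C.K c) * g := by
      rw [sub_mul, div_mul_cancel₀ _ hg0, Algebra.smul_def]
    rw [h2, v_mul, hg]
    exact WithTop.coe_le_add_of_le (m := 1) hc le_rfl (by omega)

variable (C) in
theorem v_smul_le (ξ : C.Point) (c : k) (f : C.K) : C.v ξ f ≤ C.v ξ (c • f) := by
  rw [Algebra.smul_def, v_mul]
  exact le_add_of_nonneg_left (C.v_algebraMap_nonneg ξ c)

variable (C) in
theorem v_smul (ξ : C.Point) {c : k} (hc : c ≠ 0) (f : C.K) : C.v ξ (c • f) = C.v ξ f := by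
  rw [Algebra.smul_def, v_mul, C.v_algebraMap ξ hc, zero_add]

variable (C) in
/-- A non-trivial linear combination of functions whose orders at `ξ` strictly decrease has the
order of its last term. -/
theorem v_sum_smul_of_strictAnti (ξ : C.Point) {ι : Type*} [LinearOrder ι] {u : ι → C.K}
    {e : ι → ℤ} (he : StrictAnti e) (hu : ∀ i, C.v ξ (u i) = e i) (c : ι → k) (s : Finset ι) :
    (∀ i ∈ s, c i = 0) ∨ ∃ i ∈ s, c i ≠ 0 ∧ C.v ξ (∑ i ∈ s, c i • u i) = e i := by
  induction s using Finset.induction_on_max with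
  | empty => simp
  | insert a s ha ih =>
    have hns : a ∉ s := fun h => lt_irrefl _ (ha a h)
    rw [Finset.sum_insert hns]
    by_cases hca : c a = 0
    · rcases ih with h | ⟨i, hi, hci, h⟩
      · exact Or.inl fun i hi => (Finset.mem_insert.mp hi).elim (fun h' => h' ▸ hca) (h i)
      · exact Or.inr ⟨i, Finset.mem_insert_of_mem hi, hci, by rw [hca, zero_smul, zero_add, h]⟩
    · refine Or.inr ⟨a, Finset.mem_insert_self _ _, hca, ?_⟩
      have h1 : C.v ξ (c a • u a) = e a := by rw [C.v_smul ξ hca, hu]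
      have h2 : C.v ξ (c a • u a) < C.v ξ (∑ i ∈ s, c i • u i) := by
        rw [h1]
        refine (C.addVal ξ).map_lt_sum WithTop.coe_ne_top fun i hi => ?_
        refine lt_of_lt_of_le ?_ (C.v_smul_le ξ _ _)
        rw [hu]
        exact WithTop.coe_lt_coe.mpr (he (ha i hi))
      rw [← h1]
      exact (C.addVal ξ).map_add_eq_of_lt_left h2

theorem mul_mem_localRing {ξ : C.Point} {f g : C.K} (hf : f ∈ C.localRing ξ)
    (hg : g ∈ C.localRing ξ) : f * g ∈ C.localRing ξ := by
  rw [mem_localRing_iff] at *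
  rw [v_mul]
  exact add_nonneg hf hg

theorem algebraMap_mem_localRing (ξ : C.Point) (c : k) : algebraMap k C.K c ∈ C.localRing ξ :=
  (C.mem_localRing_iff ξ _).mpr (C.v_algebraMap_nonneg ξ c)

theorem HasPoleOnlyAt.mul {inf : C.Point} {m n : ℕ} {f g : C.K} (hf : C.HasPoleOnlyAt inf m f)
    (hg : C.HasPoleOnlyAt inf n g) : C.HasPoleOnlyAt inf (m + n) (f * g) := by
  refine ⟨mem_affineRing.mpr fun ξ hξ => mul_mem_localRing (mem_affineRing.mp hf.1 ξ hξ)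
    (mem_affineRing.mp hg.1 ξ hξ), ?_⟩
  rw [v_mul, hf.2, hg.2, ← WithTop.coe_add]
  congr 1
  push_cast
  ring

theorem hasPoleOnlyAt_one (inf : C.Point) : C.HasPoleOnlyAt inf 0 1 := by
  refine ⟨mem_affineRing.mpr fun ξ _ => ?_, ?_⟩
  · rw [mem_localRing_iff, v_one]
  · rw [v_one]; rfl

theorem HasPoleOnlyAt.pow {inf : C.Point} {m : ℕ} {f : C.K} (hf : C.HasPoleOnlyAt inf m f) (n : ℕ) :
    C.HasPoleOnlyAt inf (m * n) (f ^ n) := by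
  induction n with
  | zero => simpa using hasPoleOnlyAt_one inf
  | succ n ih =>
    rw [pow_succ, Nat.mul_succ]
    exact ih.mul hf

/-- A function that is regular away from `inf` is constant if it has no pole at `inf`; otherwise it
has a pole of some positive order. -/
theorem exists_hasPoleOnlyAt {inf : C.Point} {f : C.K} (hf : f ∈ C.affineRing inf) (h0 : f ≠ 0) :
    ∃ m : ℕ, C.HasPoleOnlyAt inf m f := by
  have hv := C.v_of_ne_zero inf h0
  by_cases h : 0 ≤ Scheme.ord f inf.1
  · obtain ⟨c, rfl⟩ := C.exists_eq_algebraMap_of_forall_mem_localRing (f := f) fun ξ => by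
      by_cases hξ : ξ = inf
      · subst hξ
        rw [mem_localRing_iff, hv]
        exact_mod_cast h
      · exact mem_affineRing.mp hf ξ hξ
    refine ⟨0, hf, ?_⟩
    rw [C.v_algebraMap inf (by rintro rfl; simp at h0)]
    rfl
  · refine ⟨(Scheme.ord f inf.1).natAbs, hf, ?_⟩
    rw [hv]
    congr 1
    omega

end SmoothProperCurve

/-! ### Adeles and strong approximation -/

namespace SmoothProperCurve

variable {k : Type u} [Field k] {C : SmoothProperCurve k}

open Classical in
/-- The adele with the component `h` at `inf` and zero elsewhere. -/
noncomputable def poleAdele (inf : C.Point) : C.K →ₗ[k] C.adeles :=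
  (LinearMap.single k (fun _ : C.Point => C.K) inf).codRestrict C.adeles
    (fun h => (Set.finite_singleton inf).subset fun ξ hξ => by
      by_contra hne
      refine hξ ?_
      rw [LinearMap.single_apply, Pi.single_eq_of_ne hne]
      exact (C.localRing ξ).zero_mem)

open Classical in
theorem poleAdele_apply (inf : C.Point) (h : C.K) (ξ : C.Point) :
    (poleAdele inf h).1 ξ = if ξ = inf then h else 0 := by
  change (Pi.single inf h : C.Point → C.K) ξ = _
  rw [Pi.single_apply]

/-- The class in `H¹(X, O_X)` of a rational function, regarded as a principal part at `inf`. -/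
noncomputable def poleClass (inf : C.Point) : C.K →ₗ[k] C.H1 :=
  Submodule.mkQ _ ∘ₗ poleAdele inf

/-- A principal part at `inf` has trivial class if and only if it is that of a function that is
regular elsewhere. -/
theorem poleClass_eq_zero_iff {inf : C.Point} {h : C.K} :
    C.poleClass inf h = 0 ↔ ∃ f ∈ C.affineRing inf, h - f ∈ C.localRing inf := by
  classical
  rw [poleClass, LinearMap.comp_apply, Submodule.mkQ_apply, Submodule.Quotient.mk_eq_zero,
    Submodule.mem_comap]
  constructor
  · intro hm
    obtain ⟨_, ⟨f, rfl⟩, b, hb, hab⟩ := Submodule.mem_sup.mp hm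
    have h1 : ∀ ξ, f + b ξ = if ξ = inf then h else 0 := fun ξ =>
      (congrFun hab ξ).trans (poleAdele_apply inf h ξ)
    refine ⟨f, mem_affineRing.mpr fun ξ hξ => ?_, ?_⟩
    · have h2 := h1 ξ
      rw [if_neg hξ] at h2
      rw [eq_neg_of_add_eq_zero_left h2]
      exact (C.localRing ξ).neg_mem (hb ξ trivial)
    · have h2 := h1 inf
      rw [if_pos rfl] at h2
      rw [← h2, add_sub_cancel_left]
      exact hb inf trivial
  · rintro ⟨f, hf, hh⟩
    refine Submodule.mem_sup.mpr ⟨_, ⟨f, rfl⟩, fun ξ => if ξ = inf then h - f else - f, ?_, ?_⟩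
    · intro ξ _
      by_cases he : ξ = inf
      · subst he
        simpa using hh
      · simpa [he] using (mem_affineRing.mp hf ξ he)
    · funext ξ
      by_cases he : ξ = inf
      · subst he
        simp [poleAdele_apply]
      · simp [he, poleAdele_apply]

variable [IsAlgClosed k]

theorem mul_mem_adeles {a : C.Point → C.K} (ha : a ∈ C.adeles) (f : C.K) :
    (fun ξ => f * a ξ) ∈ C.adeles := by
  refine ((C.finite_setOf_notMem_localRing f).union ha).subset fun ξ hξ => ?_
  by_contra h
  simp only [Set.mem_union, Set.mem_ofPred_eq, not_or, not_not] at h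
  exact hξ (mul_mem_localRing h.1 h.2)

/-- Multiplication by a rational function on the adeles. -/
noncomputable def mulAdeles (f : C.K) : C.adeles →ₗ[k] C.adeles where
  toFun a := ⟨fun ξ => f * a.1 ξ, mul_mem_adeles a.2 f⟩
  map_add' _ _ := Subtype.ext (funext fun _ => mul_add _ _ _)
  map_smul' c a := Subtype.ext (funext fun ξ => mul_smul_comm c f (a.1 ξ))

theorem mulAdeles_apply (f : C.K) (a : C.adeles) (ξ : C.Point) :
    (mulAdeles f a).1 ξ = f * a.1 ξ := rfl

/-- The adeles that agree with a rational function away from `inf`, up to regular functions. -/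
noncomputable def affineAdeles (inf : C.Point) : Submodule k C.adeles where
  carrier := {a | ∃ f, ∀ ξ ≠ inf, a.1 ξ - f ∈ C.localRing ξ}
  add_mem' := by
    rintro a b ⟨f, hf⟩ ⟨g, hg⟩
    refine ⟨f + g, fun ξ hξ => ?_⟩
    have := (C.localRing ξ).add_mem (hf ξ hξ) (hg ξ hξ)
    convert this using 1
    simp only [Submodule.coe_add, Pi.add_apply]
    ring
  zero_mem' := ⟨0, fun ξ _ => by simp⟩
  smul_mem' := by
    rintro c a ⟨f, hf⟩
    refine ⟨c • f, fun ξ hξ => ?_⟩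
    have := (C.localRing ξ).smul_mem c (hf ξ hξ)
    rwa [smul_sub] at this

/-- Strong approximation away from `inf`. The quotient of the adeles by `affineAdeles` is finite
dimensional and `x` acts on it, hence a non-zero polynomial in `x` annihilates it; but this
polynomial also acts surjectively, as it is invertible in the function field. -/
theorem affineAdeles_eq_top [Module.Finite k C.H1] {inf : C.Point} {x : C.K}
    (hx : x ∈ C.affineRing inf) (hv : C.v inf x < 0) : C.affineAdeles inf = ⊤ := by
  have hle : (LinearMap.range (LinearMap.pi fun _ : C.Point => (LinearMap.id : C.K →ₗ[k] C.K)) ⊔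
      Submodule.pi Set.univ C.localRing).comap C.adeles.subtype ≤ C.affineAdeles inf := by
    intro a ha
    obtain ⟨_, ⟨f, rfl⟩, b, hb, hab⟩ := Submodule.mem_sup.mp (Submodule.mem_comap.mp ha)
    refine ⟨f, fun ξ _ => ?_⟩
    have h1 : a.1 ξ = f + b ξ := (congrFun hab ξ).symm
    rw [h1, add_sub_cancel_left]
    exact hb ξ trivial
  have hfin : Module.Finite k (C.adeles ⧸ C.affineAdeles inf) :=
    Module.Finite.of_surjective (Submodule.factor hle) (Submodule.factor_surjective hle)
  have hstab : C.affineAdeles inf ≤ (C.affineAdeles inf).comap (mulAdeles x) := by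
    rintro a ⟨f, hf⟩
    refine ⟨x * f, fun ξ hξ => ?_⟩
    have := mul_mem_localRing (mem_affineRing.mp hx ξ hξ) (hf ξ hξ)
    rwa [mul_sub, ← mulAdeles_apply] at this
  let μ : Module.End k (C.adeles ⧸ C.affineAdeles inf) :=
    (C.affineAdeles inf).mapQ (C.affineAdeles inf) (mulAdeles x) hstab
  obtain ⟨p, hp, hp0⟩ := Algebra.IsIntegral.isIntegral (R := k) μ
  have hact : ∀ (q : Polynomial k) (a : C.adeles),
      Polynomial.aeval μ q ((C.affineAdeles inf).mkQ a) =
        (C.affineAdeles inf).mkQ (mulAdeles (Polynomial.aeval x q) a) := by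
    intro q a
    induction q using Polynomial.induction_on' generalizing a with
    | add p q hp hq =>
      rw [map_add, map_add, LinearMap.add_apply, hp, hq, ← map_add]
      congr 1
      refine Subtype.ext (funext fun ξ => ?_)
      simp [mulAdeles_apply, add_mul]
    | monomial n c =>
      have hpow : ∀ a, (μ ^ n) ((C.affineAdeles inf).mkQ a) =
          (C.affineAdeles inf).mkQ (mulAdeles (x ^ n) a) := by
        induction n with
        | zero =>
          intro a
          rw [pow_zero, Module.End.one_apply]
          congr 1
          exact Subtype.ext (funext fun ξ => by simp [mulAdeles_apply])
        | succ n ih =>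
          intro a
          rw [pow_succ, Module.End.mul_apply]
          refine (ih (mulAdeles x a)).trans ?_
          congr 1
          exact Subtype.ext (funext fun ξ => by simp [mulAdeles_apply, pow_succ, mul_assoc])
      rw [Polynomial.aeval_monomial, Polynomial.aeval_monomial, Module.algebraMap_end_eq_smul_id,
        Module.End.mul_apply, LinearMap.smul_apply, LinearMap.id_apply, hpow, ← map_smul]
      congr 1
      refine Subtype.ext (funext fun ξ => ?_)
      simp [mulAdeles_apply, Algebra.smul_def, mul_assoc]
  have hpx : Polynomial.aeval x p ≠ 0 := fun h =>
    hp.ne_zero ((transcendental_iff.mp (C.transcendental_of_v_neg hv)) p h)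
  rw [eq_top_iff]
  intro a _
  have h1 := hact p (mulAdeles (Polynomial.aeval x p)⁻¹ a)
  rw [Polynomial.aeval_def, hp0, LinearMap.zero_apply] at h1
  have h2 := (Submodule.Quotient.mk_eq_zero _).mp h1.symm
  convert h2 using 1
  refine Subtype.ext (funext fun ξ => ?_)
  simp [mulAdeles_apply, mul_inv_cancel_left₀ hpx]

/-- By strong approximation, each class in `H¹(X, O_X)` comes from a principal part at `inf`. -/
theorem poleClass_surjective [Module.Finite k C.H1] {inf : C.Point} {x : C.K}
    (hx : x ∈ C.affineRing inf) (hv : C.v inf x < 0) :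
    Function.Surjective (C.poleClass inf) := by
  classical
  intro z
  obtain ⟨a, rfl⟩ := Submodule.mkQ_surjective _ z
  obtain ⟨f, hf⟩ : a ∈ C.affineAdeles inf := affineAdeles_eq_top hx hv ▸ trivial
  refine ⟨a.1 inf - f, ?_⟩
  rw [poleClass, LinearMap.comp_apply, ← sub_eq_zero, ← map_sub, Submodule.mkQ_apply,
    Submodule.Quotient.mk_eq_zero, Submodule.mem_comap, ← neg_mem_iff]
  refine Submodule.mem_sup.mpr ⟨_, ⟨f, rfl⟩, fun ξ => if ξ = inf then 0 else a.1 ξ - f, ?_, ?_⟩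
  · intro ξ _
    by_cases h : ξ = inf
    · simp [h]
    · simpa [h] using hf ξ h
  · funext ξ
    by_cases h : ξ = inf
    · subst h
      simp [poleAdele_apply]
    · simp [h, poleAdele_apply]

end SmoothProperCurve

/-! ### Gaps and the genus -/

/-- If the gaps of a numerical semigroup are finite in number, the largest one is less than twice
their number: for each gap `F` and each `a ≤ F`, one of `a` and `F - a` is a gap. -/
theorem Nat.lt_two_mul_card_of_gap {p : ℕ → Prop} (hadd : ∀ m n, p m → p n → p (m + n))
    {G : Finset ℕ} (hG : ∀ m, m ∈ G ↔ ¬ p m) {F : ℕ} (hF : ¬ p F) : F < 2 * G.card := by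
  classical
  have hsub : Finset.range (F + 1) ⊆ G ∪ G.image (F - ·) := by
    intro a ha
    have ha' : a ≤ F := Nat.lt_succ_iff.mp (Finset.mem_range.mp ha)
    by_cases h : p a
    · refine Finset.mem_union_right _ (Finset.mem_image.mpr ⟨F - a, (hG _).mpr fun h' => hF ?_, ?_⟩)
      · have := hadd a (F - a) h h'
        rwa [Nat.add_sub_cancel' ha'] at this
      · omega
    · exact Finset.mem_union_left _ ((hG a).mpr h)
  have h1 := (Finset.card_le_card hsub).trans (Finset.card_union_le _ _)
  have h2 : (G.image (F - ·)).card ≤ G.card := Finset.card_image_le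
  rw [Finset.card_range] at h1
  omega

namespace SmoothProperCurve

variable {k : Type u} [Field k] {C : SmoothProperCurve k}

/-- `m` is the order of the pole at `inf` of some function that is regular elsewhere. -/
def IsPoleOrder (inf : C.Point) (m : ℕ) : Prop := ∃ f, C.HasPoleOnlyAt inf m f

theorem HasPoleOnlyAt.v_neg {inf : C.Point} {d : ℕ} {x : C.K} (hx : C.HasPoleOnlyAt inf d x)
    (hd : 0 < d) : C.v inf x < 0 := by
  rw [hx.2]
  exact WithTop.coe_lt_coe.mpr (by omega)

variable [IsAlgClosed k]

theorem isPoleOrder_zero (inf : C.Point) : IsPoleOrder inf 0 := ⟨1, hasPoleOnlyAt_one inf⟩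

theorem IsPoleOrder.add {inf : C.Point} {m n : ℕ} (hm : IsPoleOrder inf m)
    (hn : IsPoleOrder inf n) : IsPoleOrder inf (m + n) := by
  obtain ⟨f, hf⟩ := hm
  obtain ⟨g, hg⟩ := hn
  exact ⟨f * g, hf.mul hg⟩

theorem exists_v_eq_neg (ξ : C.Point) (m : ℕ) : ∃ u : C.K, C.v ξ u = ((-m : ℤ) : WithTop ℤ) := by
  obtain ⟨t, ht⟩ := C.exists_v_eq_one ξ
  have ht0 : t ≠ 0 := by
    rintro rfl
    rw [v_zero] at ht
    exact WithTop.top_ne_one ht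
  have h1 : C.v ξ (t ^ m) = ((m : ℤ) : WithTop ℤ) := by
    rw [← addVal_apply, (C.addVal ξ).map_pow, addVal_apply, ht, nsmul_one]
    rfl
  refine ⟨(t ^ m)⁻¹, ?_⟩
  have hne := pow_ne_zero m ht0
  rw [v_of_ne_zero _ _ hne] at h1
  rw [v_of_ne_zero _ _ (inv_ne_zero hne), ord_inv _ _ hne, WithTop.coe_inj.mp h1]

/-- The genus is the number of gaps: the principal parts at `inf` of the gap orders form a basis
of `H¹(X, O_X)`. -/
theorem genus_eq_card_gaps [Module.Finite k C.H1] {inf : C.Point} {d : ℕ} {x : C.K}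
    (hx : C.HasPoleOnlyAt inf d x) (hd : 0 < d) :
    C.genus = Nat.card {m // ¬ IsPoleOrder inf m} := by
  choose u hu using exists_v_eq_neg inf
  -- a linear combination of the `u m` with zero class has the principal part of a function regular
  -- away from `inf`, whose order would be one of the gaps
  have hli : LinearIndependent k
      (fun m : {m // ¬ IsPoleOrder inf m} => C.poleClass inf (u m)) := by
    rw [linearIndependent_iff']
    intro s c hc
    have hc' : C.poleClass inf (∑ i ∈ s, c i • u i) = 0 := by
      simpa [map_sum] using hc
    obtain ⟨f, hf, hdiff⟩ := poleClass_eq_zero_iff.mp hc'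
    rcases C.v_sum_smul_of_strictAnti inf (u := fun m : {m // ¬ IsPoleOrder inf m} => u m)
      (e := fun m => -((m : ℕ) : ℤ)) (fun a b hab => neg_lt_neg (Nat.cast_lt.mpr hab))
      (fun m => hu m) c s with h | ⟨i, _, _, hi⟩
    · exact h
    · exfalso
      have hi0 : (i : ℕ) ≠ 0 := fun h0 => i.2 (h0 ▸ isPoleOrder_zero inf)
      have h1 : C.v inf (∑ i ∈ s, c i • u i) < C.v inf (∑ i ∈ s, c i • u i - f) := by
        refine lt_of_lt_of_le ?_ ((C.mem_localRing_iff inf _).mp hdiff)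
        rw [hi]
        exact WithTop.coe_lt_coe.mpr (by omega)
      refine i.2 ⟨f, hf, ?_⟩
      rw [← hi, ← addVal_apply, ← addVal_apply]
      conv_lhs => rw [← sub_sub_cancel (∑ i ∈ s, c i • u i) f]
      exact (C.addVal inf).map_sub_eq_of_lt_left h1
  -- induction on the order of the pole: the leading term is cancelled by a function regular away
  -- from `inf`, whose class is zero, or by `u m` for a gap `m`
  have hspan : ⊤ ≤ Submodule.span k (Set.range
      (fun m : {m // ¬ IsPoleOrder inf m} => C.poleClass inf (u m))) := by
    have key : ∀ (n : ℕ) (h : C.K), ((-n : ℤ) : WithTop ℤ) ≤ C.v inf h →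
        C.poleClass inf h ∈ Submodule.span k (Set.range
          (fun m : {m // ¬ IsPoleOrder inf m} => C.poleClass inf (u m))) := by
      intro n
      induction n with
      | zero =>
        intro h hh
        rw [poleClass_eq_zero_iff.mpr ⟨0, Submodule.zero_mem _, by
          rw [sub_zero, mem_localRing_iff]; exact hh⟩]
        exact Submodule.zero_mem _
      | succ n ih =>
        intro h hh
        by_cases hlt : ((-n : ℤ) : WithTop ℤ) ≤ C.v inf h
        · exact ih h hlt
        have h0 : h ≠ 0 := by
          rintro rfl
          simp [v_zero] at hlt
        have heq : C.v inf h = ((-(n + 1 : ℕ) : ℤ) : WithTop ℤ) := by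
          rw [v_of_ne_zero _ _ h0] at hh hlt ⊢
          have h1 := WithTop.coe_le_coe.mp hh
          have h2 := mt WithTop.coe_le_coe.mpr hlt
          congr 1
          push_cast at h1 ⊢
          omega
        by_cases hp : IsPoleOrder inf (n + 1)
        · obtain ⟨g, hg, hgv⟩ := hp
          obtain ⟨c, -, hc⟩ := C.exists_lt_v_sub_smul inf heq hgv
          have h1 := ih (h - c • g) (by convert! hc using 2; push_cast; ring)
          have h2 : C.poleClass inf g = 0 := poleClass_eq_zero_iff.mpr ⟨g, hg, by simp⟩
          rwa [map_sub, map_smul, h2, smul_zero, sub_zero] at h1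
        · obtain ⟨c, -, hc⟩ := C.exists_lt_v_sub_smul inf heq (hu (n + 1))
          have h1 := ih (h - c • u (n + 1)) (by convert! hc using 2; push_cast; ring)
          have h2 := Submodule.smul_mem _ c (Submodule.subset_span (R := k)
            (s := Set.range (fun m : {m // ¬ IsPoleOrder inf m} => C.poleClass inf (u m)))
            ⟨⟨n + 1, hp⟩, rfl⟩)
          have h3 := add_mem h1 h2
          rwa [map_sub, map_smul, sub_add_cancel] at h3
    intro z _
    obtain ⟨h, rfl⟩ := poleClass_surjective hx.1 (hx.v_neg hd) z
    by_cases h0 : h = 0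
    · simp [h0]
    · refine key (Scheme.ord h inf.1).natAbs h ?_
      rw [v_of_ne_zero _ _ h0]
      exact WithTop.coe_le_coe.mpr (by omega)
  exact Module.finrank_eq_nat_card_basis (Module.Basis.mk hli hspan)

theorem finite_gaps {inf : C.Point} (hg : 2 ≤ C.genus) {d : ℕ} {x : C.K}
    (hx : C.HasPoleOnlyAt inf d x) (hd : 0 < d) :
    ∃ G : Finset ℕ, (∀ m, m ∈ G ↔ ¬ IsPoleOrder inf m) ∧ G.card = C.genus := by
  classical
  have : Module.Finite k C.H1 := Module.finite_of_finrank_pos (by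
    change 0 < C.genus
    omega)
  have h := genus_eq_card_gaps hx hd
  have hfin : Finite {m // ¬ IsPoleOrder inf m} := Nat.finite_of_card_ne_zero (by omega)
  have hset : {m | ¬ IsPoleOrder inf m}.Finite := Set.finite_coe_iff.mp hfin
  refine ⟨hset.toFinset, fun m => by simp, ?_⟩
  rw [h, ← Set.ncard_eq_toFinset_card _ hset]
  rfl

/-- Since the genus is not zero, the degree of `x` is at least two: otherwise there are no gaps. -/
theorem two_le_of_hasPoleOnlyAt {inf : C.Point} (hg : 2 ≤ C.genus) {d : ℕ} {x : C.K}
    (hx : C.HasPoleOnlyAt inf d x) (hd : 0 < d) : 2 ≤ d := by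
  by_contra hlt
  obtain rfl : d = 1 := by omega
  obtain ⟨G, hG, hcard⟩ := finite_gaps hg hx hd
  obtain ⟨m, hm⟩ := Finset.card_pos.mp (by omega : 0 < G.card)
  exact (hG m).mp hm ⟨x ^ m, by simpa using hx.pow m⟩

open Classical in
/-- For `N ≥ 2g - 1` all gaps are at most `N`, hence there are `N + 1 - g` pole orders up to `N`. -/
theorem count_isPoleOrder_add_genus {inf : C.Point} (hg : 2 ≤ C.genus) {d : ℕ} {x : C.K}
    (hx : C.HasPoleOnlyAt inf d x) (hd : 0 < d) {N : ℕ} (hN : 2 * C.genus ≤ N + 1) :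
    Nat.count (IsPoleOrder inf) (N + 1) + C.genus = N + 1 := by
  obtain ⟨G, hG, hcard⟩ := finite_gaps hg hx hd
  have h1 : (Finset.range (N + 1)).filter (fun m => ¬ IsPoleOrder inf m) = G := by
    ext m
    rw [Finset.mem_filter, hG, and_iff_right_iff_imp]
    intro hm
    have := Nat.lt_two_mul_card_of_gap (fun _ _ => IsPoleOrder.add) hG hm
    rw [Finset.mem_range]
    omega
  have h2 := Finset.card_filter_add_card_filter_not (s := Finset.range (N + 1))
    (p := fun m => IsPoleOrder inf m)
  rw [h1, hcard, Finset.card_range] at h2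
  rw [Nat.count_eq_card_filter_range]
  exact h2

end SmoothProperCurve

/-! ### Pole orders and dimensions of spaces of sections -/

namespace SmoothProperCurve

variable {k : Type u} [Field k] {C : SmoothProperCurve k}

theorem poleOrder_succ (inf : C.Point) (i : ℕ) :
    C.poleOrder inf (i + 1) = Nat.nth (IsPoleOrder inf) i := rfl

variable [IsAlgClosed k]

theorem infinite_isPoleOrder {inf : C.Point} {d : ℕ} {x : C.K} (hx : C.HasPoleOnlyAt inf d x)
    (hd : 0 < d) : (Set.ofPred (IsPoleOrder inf)).Infinite :=
  Set.infinite_of_injective_forall_mem (f := fun n => d * n)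
    (fun _ _ h => Nat.eq_of_mul_eq_mul_left hd h) fun n => ⟨x ^ n, hx.pow n⟩

/-- A function with poles only at `inf` is a linear combination of the functions `y_i`, whose last
term is determined by the order of the pole. -/
theorem exists_eq_sum_smul {inf : C.Point} (hinf : (Set.ofPred (IsPoleOrder inf)).Infinite)
    {y : ℕ → C.K}
    (hy : ∀ n, 1 ≤ n → C.HasPoleOnlyAt inf (C.poleOrder inf n) (y n)) (j : ℕ) :
    ∀ f, C.HasPoleOnlyAt inf (C.poleOrder inf (j + 1)) f →
      ∃ c : ℕ → k, c j ≠ 0 ∧ f = ∑ i ∈ Finset.range (j + 1), c i • y (i + 1) := by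
  classical
  induction j using Nat.strong_induction_on with
  | _ j ih =>
    intro f hf
    have hyj := hy (j + 1) (by omega)
    obtain ⟨c, hc, hlt⟩ := C.exists_lt_v_sub_smul inf hf.2 hyj.2
    have hmem : f - c • y (j + 1) ∈ C.affineRing inf :=
      Submodule.sub_mem _ hf.1 (Submodule.smul_mem _ c hyj.1)
    by_cases h0 : f - c • y (j + 1) = 0
    · refine ⟨Pi.single j c, by simpa using hc, ?_⟩
      rw [sub_eq_zero] at h0
      rw [Finset.sum_range_succ, Finset.sum_eq_zero, Pi.single_eq_same, zero_add, h0]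
      intro i hi
      rw [Pi.single_eq_of_ne (Finset.mem_range.mp hi).ne, zero_smul]
    · obtain ⟨m, hm⟩ := exists_hasPoleOnlyAt hmem h0
      have hpm : IsPoleOrder inf m := ⟨_, hm⟩
      have hlt' : m < Nat.nth (IsPoleOrder inf) j := by
        rw [hm.2, poleOrder_succ] at hlt
        have := WithTop.coe_le_coe.mp hlt
        omega
      have hcount := Nat.nth_count hpm
      have hij : Nat.count (IsPoleOrder inf) m < j := by
        rw [← hcount] at hlt'
        exact (Nat.nth_lt_nth hinf).mp hlt'
      rw [← hcount] at hm
      obtain ⟨e, -, he⟩ := ih _ hij _ hm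
      refine ⟨fun i => if i = j then c else
        if i < Nat.count (IsPoleOrder inf) m + 1 then e i else 0, by simpa using hc, ?_⟩
      simp only [Finset.sum_range_succ _ j, if_true]
      rw [← sub_eq_iff_eq_add, he]
      have hsub : Finset.range (Nat.count (IsPoleOrder inf) m + 1) ⊆ Finset.range j :=
        Finset.range_subset_range.mpr hij
      rw [← Finset.sum_subset hsub]
      · refine Finset.sum_congr rfl fun i hi => ?_
        have h1 := Finset.mem_range.mp hi
        rw [if_neg (by omega), if_pos h1]
      · intro i hi hni
        have h1 := Finset.mem_range.mp hi
        rw [Finset.mem_range] at hni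
        rw [if_neg (by omega), if_neg hni, zero_smul]

open Classical in
/-- The dimension of `H⁰(X, O_X(N [inf]))` is the number of orders of poles that are at most `N`:
the functions `y_i` with these orders form a basis. -/
theorem dimSections_eq_count {inf : C.Point} {d : ℕ} {x : C.K} (hx : C.HasPoleOnlyAt inf d x)
    (hd : 0 < d) {y : ℕ → C.K}
    (hy : ∀ n, 1 ≤ n → C.HasPoleOnlyAt inf (C.poleOrder inf n) (y n)) (N : ℕ) :
    C.dimSections inf N = Nat.count (IsPoleOrder inf) (N + 1) := by
  have hinf := infinite_isPoleOrder hx hd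
  have hli : LinearIndependent k (fun i : ℕ => y (i + 1)) := by
    rw [linearIndependent_iff']
    intro s c hc
    rcases C.v_sum_smul_of_strictAnti inf (u := fun i : ℕ => y (i + 1))
      (e := fun i => -((C.poleOrder inf (i + 1) : ℕ) : ℤ))
      (fun a b hab => neg_lt_neg (Nat.cast_lt.mpr (Nat.nth_strictMono hinf hab)))
      (fun i => (hy (i + 1) (by omega)).2) c s with h | ⟨i, _, _, hi⟩
    · exact h
    · rw [hc, v_zero] at hi
      exact absurd hi WithTop.top_ne_coe
  set n := Nat.count (IsPoleOrder inf) (N + 1) with hn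
  have hspan : Submodule.span k (C.sections inf N) =
      Submodule.span k (Set.range fun i : Fin n => y (i + 1)) := by
    apply le_antisymm
    · refine Submodule.span_le.mpr fun f hf => ?_
      by_cases h0 : f = 0
      · rw [h0]; exact Submodule.zero_mem _
      obtain ⟨m, hm⟩ := exists_hasPoleOnlyAt hf.1 h0
      have hpm : IsPoleOrder inf m := ⟨_, hm⟩
      have hmN : m ≤ N := by
        have := hf.2
        rw [hm.2] at this
        have := WithTop.coe_le_coe.mp this
        omega
      have hcount := Nat.nth_count hpm
      have hlt : Nat.count (IsPoleOrder inf) m < n := by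
        rw [hn]
        exact Nat.count_strict_mono hpm (by omega)
      rw [← hcount] at hm
      obtain ⟨c, -, rfl⟩ := exists_eq_sum_smul hinf hy _ f hm
      refine Submodule.sum_mem _ fun i hi => Submodule.smul_mem _ _ (Submodule.subset_span ?_)
      have := Finset.mem_range.mp hi
      exact ⟨⟨i, lt_of_lt_of_le this hlt⟩, rfl⟩
    · refine Submodule.span_mono ?_
      rintro _ ⟨i, rfl⟩
      have h1 := hy (i + 1) (by omega)
      refine ⟨h1.1, ?_⟩
      rw [h1.2]
      have h2 : Nat.nth (IsPoleOrder inf) i < N + 1 := Nat.nth_lt_of_lt_count i.2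
      rw [← poleOrder_succ] at h2
      exact WithTop.coe_le_coe.mpr (by omega)
  rw [dimSections, Set.finrank, hspan]
  exact (finrank_span_eq_card (hli.comp _ Fin.val_injective)).trans (Fintype.card_fin n)

end SmoothProperCurve

/-! ### Orders of determinants, torsion points and ramification -/

/-- The sum of a finite set of natural numbers is at least that of the first ones. -/
theorem Finset.sum_range_card_le_sum (s : Finset ℕ) :
    ∑ i ∈ Finset.range s.card, i ≤ ∑ i ∈ s, i := by
  induction s using Finset.induction_on_max with
  | empty => simp
  | insert a s ha ih =>
    have hns : a ∉ s := fun h => lt_irrefl _ (ha a h)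
    rw [Finset.card_insert_of_notMem hns, Finset.sum_range_succ, Finset.sum_insert hns, add_comm]
    refine add_le_add ?_ ih
    have hsub : s ⊆ Finset.range a := fun i hi => Finset.mem_range.mpr (ha i hi)
    simpa using Finset.card_le_card hsub

/-- The sum of `ℓ` distinct elements of `{0, …, n - 1}` is at most that of the last ones. -/
theorem Fin.sum_val_le_of_injective {ℓ n : ℕ} {τ : Fin ℓ → Fin n} (hτ : Function.Injective τ) :
    ∑ m, ((τ m : ℕ) : ℤ) ≤ ∑ m : Fin ℓ, ((n : ℤ) - 1 - (m : ℕ)) := by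
  have hinj : Function.Injective fun m => n - 1 - (τ m : ℕ) := by
    intro a b hab
    apply hτ
    have h1 := (τ a).2
    have h2 := (τ b).2
    simp only at hab
    omega
  have h := Finset.sum_range_card_le_sum (Finset.univ.image fun m => n - 1 - (τ m : ℕ))
  rw [Finset.card_image_of_injective _ hinj, Finset.sum_image hinj.injOn, Finset.card_fin,
    ← Fin.sum_univ_eq_sum_range (fun i => i)] at h
  have h' : ∑ m : Fin ℓ, ((m : ℕ) : ℤ) ≤ ∑ m, ((n : ℤ) - 1 - (τ m : ℕ)) := by
    have h2 : ∀ m, ((n : ℤ) - 1 - (τ m : ℕ)) = ((n - 1 - (τ m : ℕ) : ℕ) : ℤ) := by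
      intro m
      have := (τ m).2
      omega
    simp_rw [h2]
    exact_mod_cast h
  simp only [Finset.sum_sub_distrib] at h' ⊢
  linarith

namespace SmoothProperCurve

variable {k : Type u} [Field k] {C : SmoothProperCurve k}

/-- The point `inf` is ramified, as the order of the pole of `x` is at least two. -/
theorem inf_mem_ramificationPoints {inf : C.Point} {d : ℕ} {x : C.K}
    (hx : C.HasPoleOnlyAt inf d x) (hd : 2 ≤ d) : inf ∈ C.ramificationPoints x := by
  refine Or.inr ?_
  have hx0 : x ≠ 0 := by
    rintro rfl
    have := hx.2
    rw [v_zero] at this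
    exact WithTop.top_ne_coe this
  have h1 := hx.2
  rw [v_of_ne_zero _ _ hx0] at h1
  rw [v_of_ne_zero _ _ (inv_ne_zero hx0), ord_inv _ _ hx0, WithTop.coe_inj.mp h1]
  exact WithTop.coe_le_coe.mpr (show (2 : ℤ) ≤ _ by omega)

variable [IsAlgClosed k]

/-- Lower bounds for the orders of the entries of a matrix give one for the determinant. -/
theorem le_v_det (ξ : C.Point) {n : ℕ} (A : Matrix (Fin n) (Fin n) C.K) (B : Fin n → Fin n → ℤ)
    (hB : ∀ i j, (B i j : WithTop ℤ) ≤ C.v ξ (A i j)) {b : ℤ}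
    (hb : ∀ σ : Equiv.Perm (Fin n), b ≤ ∑ i, B (σ i) i) : (b : WithTop ℤ) ≤ C.v ξ A.det := by
  rw [Matrix.det_apply, ← addVal_apply]
  refine (C.addVal ξ).map_le_sum fun σ _ => ?_
  have hsign : C.addVal ξ (Equiv.Perm.sign σ • ∏ i, A (σ i) i) =
      C.addVal ξ (∏ i, A (σ i) i) := by
    rcases Int.units_eq_one_or (Equiv.Perm.sign σ) with h | h
    · rw [h, one_smul]
    · rw [h, Units.neg_smul, one_smul, (C.addVal ξ).map_neg]
  rw [hsign]
  have hprod : ∀ s : Finset (Fin n), ((∑ i ∈ s, B (σ i) i : ℤ) : WithTop ℤ) ≤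
      C.addVal ξ (∏ i ∈ s, A (σ i) i) := by
    classical
    intro s
    induction s using Finset.induction_on with
    | empty => simp
    | insert a s ha ih =>
      rw [Finset.sum_insert ha, Finset.prod_insert ha, (C.addVal ξ).map_mul]
      exact WithTop.coe_le_add_of_le (hB _ _) ih le_rfl
  exact (WithTop.coe_le_coe.mpr (hb σ)).trans (hprod _)

/-- Up to a non-zero constant, the minors do not depend on the choice of the functions `y_n`: two
choices differ by a triangular matrix with constant entries. -/
theorem v_det_eq_of_hasPoleOnlyAt {inf : C.Point}
    (hinf : (Set.ofPred (IsPoleOrder inf)).Infinite) {y z : ℕ → C.K}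
    (hy : ∀ n, 1 ≤ n → C.HasPoleOnlyAt inf (C.poleOrder inf n) (y n))
    (hz : ∀ n, 1 ≤ n → C.HasPoleOnlyAt inf (C.poleOrder inf n) (z n)) (ξ : C.Point) {n : ℕ}
    (L : Fin n → C.K →ₗ[k] C.K) :
    C.v ξ (Matrix.of fun i j : Fin n => L j (y (i + 1))).det =
      C.v ξ (Matrix.of fun i j : Fin n => L j (z (i + 1))).det := by
  choose c hc hzc using fun i : ℕ =>
    exists_eq_sum_smul hinf hy i (z (i + 1)) (hz (i + 1) (by omega))
  -- the cut-off is needed as `c i l` is arbitrary for `l > i`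
  let P : Matrix (Fin n) (Fin n) k := Matrix.of fun i j => if (j : ℕ) ≤ i then c i j else 0
  have hP : P.det = ∏ i : Fin n, c i i := by
    rw [Matrix.det_of_isLowerTriangular]
    · simp [P]
    · intro i j hij
      exact if_neg (not_le.mpr hij)
  have hmul : (Matrix.of fun i j : Fin n => L j (z (i + 1))) =
      P.map (algebraMap k C.K) * (Matrix.of fun i j : Fin n => L j (y (i + 1))) := by
    ext i j
    rw [Matrix.mul_apply, Matrix.of_apply, hzc, map_sum]
    simp only [Matrix.map_apply, Matrix.of_apply, map_smul, P]
    rw [Fin.sum_univ_eq_sum_range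
      (fun l => algebraMap k C.K (if l ≤ (i : ℕ) then c i l else 0) * L j (y (l + 1))) n,
      ← Finset.sum_subset (Finset.range_subset_range.mpr (Nat.succ_le_of_lt i.2))]
    · refine Finset.sum_congr rfl fun l hl => ?_
      rw [if_pos (Nat.lt_succ_iff.mp (Finset.mem_range.mp hl)), Algebra.smul_def]
    · intro l _ hl
      rw [if_neg fun h => hl (Finset.mem_range.mpr (Nat.lt_succ_of_le h)), map_zero, zero_mul]
  have hdet : (P.map (algebraMap k C.K)).det = algebraMap k C.K P.det :=
    ((algebraMap k C.K).map_det P).symm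
  rw [hmul, Matrix.det_mul, hdet, v_mul, C.v_algebraMap ξ, zero_add]
  rw [hP]
  exact Finset.prod_ne_zero_iff.mpr fun i _ => hc i

/-- A torsion point `ξ ≠ inf` gives a function with a zero of order `N` at `ξ` and a pole of
order `N` at `inf`. -/
theorem exists_hasPoleOnlyAt_of_mem_torsionPoints {inf ξ : C.Point} {N : ℕ}
    (hξ : ξ ∈ C.torsionPoints inf N) (hne : ξ ≠ inf) :
    ∃ f, C.HasPoleOnlyAt inf N f ∧ C.v ξ f = ((N : ℤ) : WithTop ℤ) := by
  have h0 : N • C.abelJacobi inf ξ = 0 := hξ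
  rw [abelJacobi, ← QuotientAddGroup.mk_nsmul, QuotientAddGroup.eq_zero_iff] at h0
  obtain ⟨f, -, hf⟩ := AddSubgroup.mem_addSubgroupOf.mp h0
  refine ⟨f, ⟨mem_affineRing.mpr fun η hη => ?_, ?_⟩, ?_⟩
  · rw [mem_localRing_iff, hf η]
    refine WithTop.coe_le_coe.mpr ?_
    by_cases h : η = ξ <;> simp [h, Ne.symm hη, hne, eq_comm]
  · rw [hf inf]
    simp [hne]
  · rw [hf ξ]
    simp [Ne.symm hne]

/-- At an unramified point where `x` is finite, some `x - c` is a uniformizer. -/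
theorem exists_v_sub_eq_one {inf ξ : C.Point} (hne : ξ ≠ inf) {x : C.K}
    (hx : x ∈ C.affineRing inf) (hram : ξ ∉ C.ramificationPoints x) :
    ∃ c : k, C.v ξ (x - algebraMap k C.K c) = 1 := by
  obtain ⟨c, hc⟩ := C.exists_one_le_v_sub ξ
    ((C.mem_localRing_iff ξ x).mp (mem_affineRing.mp hx ξ hne))
  have h2 : ¬ 2 ≤ C.v ξ (x - algebraMap k C.K c) := fun h => hram (Or.inl ⟨c, h⟩)
  refine ⟨c, ?_⟩
  by_cases h0 : x - algebraMap k C.K c = 0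
  · simp [h0, v_zero] at h2
  · rw [v_of_ne_zero _ _ h0] at hc h2 ⊢
    have h3 : (1 : ℤ) ≤ Scheme.ord (x - algebraMap k C.K c) ξ.1 := WithTop.coe_le_coe.mp hc
    have h4 : ¬ (2 : ℤ) ≤ Scheme.ord (x - algebraMap k C.K c) ξ.1 := mt WithTop.coe_le_coe.mpr h2
    have h5 : Scheme.ord (x - algebraMap k C.K c) ξ.1 = 1 := by omega
    rw [h5]
    rfl

theorem HasPoleOnlyAt.sub_algebraMap {inf : C.Point} {d : ℕ} {x : C.K}
    (hx : C.HasPoleOnlyAt inf d x) (hd : 0 < d) (c : k) :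
    C.HasPoleOnlyAt inf d (x - algebraMap k C.K c) := by
  refine ⟨mem_affineRing.mpr fun ξ hξ => (C.localRing ξ).sub_mem (mem_affineRing.mp hx.1 ξ hξ)
    (algebraMap_mem_localRing ξ c), ?_⟩
  rw [← hx.2]
  exact (C.addVal inf).map_sub_eq_of_lt_left
    (lt_of_lt_of_le (hx.v_neg hd) (C.v_algebraMap_nonneg inf c))

end SmoothProperCurve

/-! ### Orders of vanishing of the minors at torsion points -/

theorem mainTheorem3 {k : Type u} [Field k] [IsAlgClosed k] (C : SmoothProperCurve k)
    (hg : 2 ≤ C.genus) (inf : C.Point)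
    (d : ℕ) (hd : 0 < d) (x : C.K) (hx : C.HasPoleOnlyAt inf d x)
    (hsep : Algebra.IsSeparable (IntermediateField.adjoin k {x}) C.K)
    (y : ℕ → C.K) (hy : ∀ n, 1 ≤ n → C.HasPoleOnlyAt inf (C.poleOrder inf n) (y n))
    (N : ℕ) (hN : 2 ≤ N) (ξ : C.Point) (hξ : ξ ∈ C.torsionPoints inf N)
    (hram : ξ ∉ C.ramificationPoints x) :
    -- (i): `last` is the last index, so that `s last + 1` is the column number `s_{D_N}`
    (∀ (s : Fin (C.dimSections inf N) ↪o Fin N) (last : Fin (C.dimSections inf N)),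
      (last : ℕ) + 1 = C.dimSections inf N →
        (((N : ℤ) + 1 - (((s last : ℕ) + 1 : ℕ) : ℤ) : ℤ) : WithTop ℤ) ≤
          C.v ξ (C.minorPi inf x y N s)) ∧
    -- (ii)
    (∀ r ℓ : ℕ, ℓ = r / d + 1 →
      (((ℓ : ℤ) * ((N : ℤ) + (ℓ : ℤ) - (C.dimSections inf (N + r) : ℤ)) : ℤ) : WithTop ℤ) ≤
        C.v ξ (C.Delta inf x y (N + r))) ∧
    -- the case `N ≥ 2g - 1`
    (2 * (C.genus : ℤ) - 1 ≤ (N : ℤ) → ∀ r ℓ : ℕ, ℓ = r / d + 1 →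
      (ℓ : ℤ) * ((N : ℤ) + (ℓ : ℤ) - (C.dimSections inf (N + r) : ℤ)) =
        ((C.genus : ℤ) - (r : ℤ) + ((r / d : ℕ) : ℤ)) * (((r / d : ℕ) : ℤ) + 1) ∧
      ((((C.genus : ℤ) - (r : ℤ) + ((r / d : ℕ) : ℤ)) * (((r / d : ℕ) : ℤ) + 1) : ℤ) :
          WithTop ℤ) ≤ C.v ξ (C.Delta inf x y (N + r))) := by
  classical
  have hne : ξ ≠ inf := by
    rintro rfl
    exact hram (SmoothProperCurve.inf_mem_ramificationPoints hx
      (SmoothProperCurve.two_le_of_hasPoleOnlyAt hg hx hd))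
  obtain ⟨f, hf, hfξ⟩ := SmoothProperCurve.exists_hasPoleOnlyAt_of_mem_torsionPoints hξ hne
  obtain ⟨c, hc⟩ := SmoothProperCurve.exists_v_sub_eq_one hne hx.1 hram
  have hinf := SmoothProperCurve.infinite_isPoleOrder hx hd
  have hreg : ∀ η ≠ inf, ∀ n, 1 ≤ n → 0 ≤ C.v η (y n) := fun η hη n hn =>
    (C.mem_localRing_iff η _).mp (SmoothProperCurve.mem_affineRing.mp (hy n hn).1 η hη)
  have hint : ∀ n, 1 ≤ n → ∀ i, 0 ≤ C.v ξ (hasseSchmidt k x i (y n)) := fun n hn i =>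
    (C.le_v_hasseSchmidt (hx.v_neg hd) hsep hc (m := 0) (by simpa using hreg ξ hne n hn) i).2
  -- the functions `f * (x - c) ^ m`, with a zero of order `N + m` at `ξ`
  have hpole : ∀ m : ℕ, C.HasPoleOnlyAt inf (N + d * m) (f * (x - algebraMap k C.K c) ^ m) :=
    fun m => hf.mul ((hx.sub_algebraMap hd c).pow m)
  have hzero : ∀ m i : ℕ, (((N + m : ℕ) - i : ℤ) : WithTop ℤ) ≤
      C.v ξ (hasseSchmidt k x i (f * (x - algebraMap k C.K c) ^ m)) ∧
      0 ≤ C.v ξ (hasseSchmidt k x i (f * (x - algebraMap k C.K c) ^ m)) := by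
    intro m i
    refine C.le_v_hasseSchmidt (hx.v_neg hd) hsep hc (m := N + m) ?_ i
    have h1 : C.v ξ ((x - algebraMap k C.K c) ^ m) = ((m : ℤ) : WithTop ℤ) := by
      rw [← C.addVal_apply, (C.addVal ξ).map_pow, C.addVal_apply, hc, nsmul_one]
      rfl
    rw [C.v_mul, hfξ, h1, ← WithTop.coe_add]
    exact WithTop.coe_le_coe.mpr (le_of_eq (Nat.cast_add N m))
  have hpN : ∀ m, SmoothProperCurve.IsPoleOrder inf (N + d * m) := fun m => ⟨_, hpole m⟩
  have hcount := SmoothProperCurve.dimSections_eq_count hx hd hy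
  have part2 : ∀ r ℓ : ℕ, ℓ = r / d + 1 →
      (((ℓ : ℤ) * ((N : ℤ) + (ℓ : ℤ) - (C.dimSections inf (N + r) : ℤ)) : ℤ) : WithTop ℤ) ≤
        C.v ξ (C.Delta inf x y (N + r)) := by
    intro r ℓ hℓ
    -- the rows of pole order `N + d * m`, `m < ℓ`, can be taken to come from `f * (x - c) ^ m`
    let z : ℕ → C.K := fun n => if h : ∃ m < ℓ, C.poleOrder inf n = N + d * m then
      f * (x - algebraMap k C.K c) ^ h.choose else y n
    have hz : ∀ n, 1 ≤ n → C.HasPoleOnlyAt inf (C.poleOrder inf n) (z n) := by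
      intro n hn
      by_cases h : ∃ m < ℓ, C.poleOrder inf n = N + d * m
      · simp only [z, dif_pos h]
        have h1 := hpole h.choose
        exact ⟨h1.1, h1.2.trans (congrArg (fun e : ℕ => ((-(e : ℤ) : ℤ) : WithTop ℤ))
          h.choose_spec.2.symm)⟩
      · simp only [z, dif_neg h]
        exact hy n hn
    have hlt : ∀ m : Fin ℓ, Nat.count (SmoothProperCurve.IsPoleOrder inf) (N + d * m) <
        C.dimSections inf (N + r) := by
      intro m
      rw [hcount]
      refine Nat.count_strict_mono (hpN m) ?_
      have h1 : (m : ℕ) ≤ r / d := by have := m.2; omega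
      have h2 : d * m ≤ r := (Nat.mul_le_mul_left d h1).trans (Nat.mul_div_le r d)
      omega
    -- `R m` is the index of the row of pole order `N + d * m`
    let R : Fin ℓ → Fin (C.dimSections inf (N + r)) := fun m => ⟨_, hlt m⟩
    have hR : ∀ m, C.poleOrder inf ((R m : ℕ) + 1) = N + d * m := fun m => Nat.nth_count (hpN m)
    have hRinj : Function.Injective R := by
      intro a b hab
      have h1 := hR a
      rw [hab, hR b] at h1
      exact Fin.ext (Nat.eq_of_mul_eq_mul_left hd (Nat.add_left_cancel h1)).symm
    have hzR : ∀ m, z ((R m : ℕ) + 1) = f * (x - algebraMap k C.K c) ^ (m : ℕ) := by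
      intro m
      have h : ∃ m' < ℓ, C.poleOrder inf ((R m : ℕ) + 1) = N + d * m' := ⟨m, m.2, hR m⟩
      simp only [z, dif_pos h]
      have h1 := (hR m).symm.trans h.choose_spec.2
      exact congrArg (fun e => f * (x - algebraMap k C.K c) ^ e)
        (Nat.eq_of_mul_eq_mul_left hd (Nat.add_left_cancel h1)).symm
    have hzint : ∀ n, 1 ≤ n → ∀ i, 0 ≤ C.v ξ (hasseSchmidt k x i (z n)) := by
      intro n hn i
      by_cases h : ∃ m < ℓ, C.poleOrder inf n = N + d * m
      · simp only [z, dif_pos h]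
        exact (hzero _ i).2
      · simp only [z, dif_neg h]
        exact hint n hn i
    rw [SmoothProperCurve.Delta, SmoothProperCurve.v_det_eq_of_hasPoleOnlyAt hinf hy hz ξ
      (fun j => hasseSchmidt k x j)]
    -- the bound for the entries is zero outside the rows `R m`
    refine SmoothProperCurve.le_v_det ξ _
      (fun i j => ∑ m, if R m = i then ((N + m : ℕ) - j : ℤ) else 0) (fun i j => ?_) fun σ => ?_
    · rw [Matrix.of_apply]
      by_cases h : ∃ m, R m = i
      · obtain ⟨m, rfl⟩ := h
        simp only [hRinj.eq_iff, Finset.sum_ite_eq', Finset.mem_univ, if_true]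
        rw [hzR]
        exact (hzero m j).1
      · rw [Finset.sum_eq_zero fun m _ => if_neg fun hm => h ⟨m, hm⟩]
        exact hzint _ (by omega) _
    · rw [Finset.sum_comm]
      have hσ : ∀ m, (∑ i, if R m = σ i then ((N + m : ℕ) - (i : ℕ) : ℤ) else 0) =
          (N + m : ℕ) - ((σ.symm (R m) : ℕ) : ℤ) := by
        intro m
        simp [← Equiv.symm_apply_eq]
      simp_rw [hσ]
      -- the worst permutation puts the rows `R m` into the last `ℓ` columns
      have h1 := Fin.sum_val_le_of_injective (σ.symm.injective.comp hRinj)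
      simp only [Function.comp_apply] at h1
      have h2 : ∀ L : ℕ, ∑ m : Fin L, ((m : ℕ) : ℤ) * 2 = L * (L - 1) := by
        intro L
        rw [← Finset.sum_mul, Fin.sum_univ_eq_sum_range (fun m => (m : ℤ))]
        induction L with
        | zero => simp
        | succ L ih =>
          rw [Finset.sum_range_succ, add_mul, ih]
          push_cast
          ring
      have h3 := h2 ℓ
      rw [← Finset.sum_mul] at h3
      simp only [Finset.sum_sub_distrib, Nat.cast_add, Finset.sum_add_distrib, Finset.sum_const,
        Finset.card_univ, Fintype.card_fin, nsmul_eq_mul, mul_one] at h1 ⊢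
      linarith
  refine ⟨?_, part2, ?_⟩
  · intro s last hlast
    have hpN0 : SmoothProperCurve.IsPoleOrder inf N := ⟨f, hf⟩
    -- the last row has pole order `N`, since `f` has this order
    have hlastN : C.poleOrder inf ((last : ℕ) + 1) = N := by
      rw [SmoothProperCurve.poleOrder_succ]
      have h1 := hcount N
      rw [Nat.count_succ, if_pos hpN0] at h1
      have h2 : (last : ℕ) = Nat.count (SmoothProperCurve.IsPoleOrder inf) N := by omega
      rw [h2, Nat.nth_count hpN0]
    -- the last row can be taken to come from `f`
    let z : ℕ → C.K := Function.update y ((last : ℕ) + 1) f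
    have hz : ∀ n, 1 ≤ n → C.HasPoleOnlyAt inf (C.poleOrder inf n) (z n) := by
      intro n hn
      by_cases h : n = (last : ℕ) + 1
      · subst h
        rw [hlastN]
        simpa [z] using hf
      · simpa [z, Function.update_of_ne h] using hy n hn
    have hminor := SmoothProperCurve.v_det_eq_of_hasPoleOnlyAt hinf hy hz ξ
      (fun j => hasseSchmidt k x (s j))
    refine le_of_le_of_eq ?_ hminor.symm
    refine SmoothProperCurve.le_v_det ξ _
      (fun i _ => if i = last then (N : ℤ) - (s last : ℕ) else 0) (fun i j => ?_) fun σ => ?_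
    · rw [Matrix.of_apply]
      by_cases h : i = last
      · subst h
        rw [if_pos rfl]
        refine le_trans (WithTop.coe_le_coe.mpr ?_) (le_of_le_of_eq (hzero 0 (s j)).1 ?_)
        · have h1 : j ≤ i := by
            have := j.2
            rw [Fin.le_def]
            omega
          have h2 : (s j : ℕ) ≤ s i := Fin.le_def.mp (s.monotone h1)
          push_cast
          omega
        · simp [z]
      · rw [if_neg h]
        have h1 : (i : ℕ) + 1 ≠ (last : ℕ) + 1 := fun h' => h (Fin.ext (by omega))
        simp only [z, Function.update_of_ne h1]
        exact hint _ (by omega) _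
    · have h1 : ∀ i, σ i = last ↔ i = σ.symm last := fun i => by
        rw [Equiv.eq_symm_apply]
      simp only [h1, Finset.sum_ite_eq', Finset.mem_univ, if_true]
      push_cast
      omega
  · intro hN2 r ℓ hℓ
    have hcg := SmoothProperCurve.count_isPoleOrder_add_genus hg hx hd (N := N + r) (by omega)
    have heq : (ℓ : ℤ) * ((N : ℤ) + (ℓ : ℤ) - (C.dimSections inf (N + r) : ℤ)) =
        ((C.genus : ℤ) - (r : ℤ) + ((r / d : ℕ) : ℤ)) * (((r / d : ℕ) : ℤ) + 1) := by
      have h1 : (C.dimSections inf (N + r) : ℤ) = N + r + 1 - C.genus := by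
        rw [hcount]
        omega
      rw [h1, hℓ, Nat.cast_add, Nat.cast_one]
      ring
    exact ⟨heq, heq ▸ part2 r ℓ hℓ⟩
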